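/- Let $d$ and $k\ge 2$ be integers, $d \ge 0$, and put $p_k=\frac{2^k}{k+1}$ and $s_k=\frac{2^k}{2^k-k-1}$, which are Hölder conjugate. All functions are real-valued on $\mathbb{R}^d$ and may take both signs. The Gowers–Host–Kra norms are defined inductively by $$\|f\|_{U(1)}=\Big|\int_{\mathbb{R}^d} f\,dx\Big|,\qquad \|f\|_{U(j+1)}^{2^{j+1}}=\int_{\mathbb{R}^d}\big\|f(\cdot+h)\,f\big\|_{U(j)}^{2^{j}}\,dh\quad(j\ge 1),$$ and the dual function of $f$ is $$D_kf(x)=\int_{(\mathbb{R}^{d})^k}\ \prod_{\alpha\in\{0,1\}^k\setminus\{0\}} f(x+\alpha_1h_1+\cdots+\alpha_kh_k)\,dh_1\cdots dh_k .$$ The $k$-th anti-uniform space $\mathcal{U}^*(k)$ consists of all $g\in L^{s_k}(\mathbb{R}^d)$ with $$\|g\|_{U(k)}^*:=\sup\Big\{\Big|\int_{\mathbb{R}^d} g f\,dx\Big| : f\in L^{p_k}(\mathbb{R}^d),\ \|f\|_{U(k)}\le 1\Big\}<\infty .$$ Then for every $f\in L^{p_k}(\mathbb{R}^d)$ the integral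 defining $D_kf(x)$ converges absolutely for almost every $x$ and $D_kf\in L^{s_k}(\mathbb{R}^d)$; and the closed unit ball $\{g\in\mathcal{U}^*(k):\|g\|_{U(k)}^*\le 1\}$ equals the closed convex hull in $L^{s_k}(\mathbb{R}^d)$ of the set $$\{D_kf : f\in L^{p_k}(\mathbb{R}^d),\ \|f\|_{U(k)}\le 1\}.$$ -/

import Mathlib

open MeasureTheory
open scoped ENNReal

noncomputable section

namespace AntiUniform

/-- The exponent `p_k = 2^k / (k + 1)`. -/
def pExp (k : ℕ) : ℝ≥0∞ := ENNReal.ofReal ((2 : ℝ) ^ k / ((k : ℝ) + 1))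

/-- The exponent `s_k = 2^k / (2^k - k - 1)`, the Hölder conjugate of `p_k` when `k ≥ 2`. -/
def sExp (k : ℕ) : ℝ≥0∞ := ENNReal.ofReal ((2 : ℝ) ^ k / ((2 : ℝ) ^ k - (k : ℝ) - 1))

theorem one_le_sExp {k : ℕ} (hk : 2 ≤ k) : 1 ≤ sExp k := by
  have hlt : k + 1 < 2 ^ k := by
    induction k, hk using Nat.le_induction with
    | base => norm_num
    | succ n hn ih => rw [pow_succ]; omega
  have hR : (k : ℝ) + 1 < (2 : ℝ) ^ k := by exact_mod_cast hlt
  have h0 : (0 : ℝ) ≤ (k : ℝ) := Nat.cast_nonneg k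
  rw [sExp, ENNReal.one_le_ofReal, le_div_iff₀ (by linarith)]
  linarith

instance sExp_fact (k : ℕ) [hk : Fact (2 ≤ k)] : Fact (1 ≤ sExp k) :=
  ⟨one_le_sExp hk.out⟩

/-- The Gowers-Host-Kra norm `‖f‖_{U(k)}` of a real function on `ℝ^d`, defined inductively by
`‖f‖_{U(1)} = |∫ f|` and `‖f‖_{U(k+1)}^{2^(k+1)} = ∫ ‖f(· + h) f‖_{U(k)}^{2^k} dh`.
The index `0` carries no meaning and is never used. -/
def gowersNorm {d : ℕ} : ℕ → (EuclideanSpace ℝ (Fin d) → ℝ) → ℝ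
  | 0, _ => 0
  | 1, f => |∫ x, f x|
  | (k + 2), f =>
      (∫ h : EuclideanSpace ℝ (Fin d),
        gowersNorm (k + 1) (fun x => f (x + h) * f x) ^ (2 ^ (k + 1) : ℕ)) ^
          ((1 : ℝ) / (2 : ℝ) ^ (k + 2))

/-- `α · h = α₁ h₁ + ⋯ + α_k h_k` for a vertex `α` of the cube `{0,1}^k`. -/
def cubeDot {d k : ℕ} (α : Fin k → Bool) (h : Fin k → EuclideanSpace ℝ (Fin d)) :
    EuclideanSpace ℝ (Fin d) :=
  ∑ i, if α i then h i else 0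

/-- The integrand `∏_{α ∈ {0,1}^k, α ≠ 0} f(x + α · h)` of the dual function. -/
def dualIntegrand {d : ℕ} (k : ℕ) (f : EuclideanSpace ℝ (Fin d) → ℝ)
    (x : EuclideanSpace ℝ (Fin d)) (h : Fin k → EuclideanSpace ℝ (Fin d)) : ℝ :=
  ∏ α ∈ Finset.univ.erase (fun _ : Fin k => false), f (x + cubeDot α h)

/-- The Gowers-Host-Kra dual function
`D_k f (x) = ∫_{ℝ^{kd}} ∏_{α ∈ {0,1}^k, α ≠ 0} f(x + α · h) dh`. -/
def dualFunction {d : ℕ} (k : ℕ) (f : EuclideanSpace ℝ (Fin d) → ℝ)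
    (x : EuclideanSpace ℝ (Fin d)) : ℝ :=
  ∫ h : Fin k → EuclideanSpace ℝ (Fin d), dualIntegrand k f x h

/-- The set of values `|⟨g, f⟩|`, for `f ∈ L^{p_k}` with `‖f‖_{U(k)} ≤ 1`. -/
def pairingValues {d : ℕ} (k : ℕ) (g : EuclideanSpace ℝ (Fin d) → ℝ) : Set ℝ :=
  {r | ∃ f : EuclideanSpace ℝ (Fin d) → ℝ,
    MemLp f (pExp k) volume ∧ gowersNorm k f ≤ 1 ∧ r = |∫ x, g x * f x|}

/-- The anti-uniform norm `‖g‖*_{U(k)}`, the supremum of the values `|⟨g, f⟩|`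
(meaningful for `g` in the anti-uniform space, where the supremum is finite). -/
def antiUniformNorm {d : ℕ} (k : ℕ) (g : EuclideanSpace ℝ (Fin d) → ℝ) : ℝ :=
  sSup (pairingValues k g)

/-- The `k`-th anti-uniform space: those `g ∈ L^{s_k}` for which the supremum of `|⟨g, f⟩|`
over `f ∈ L^{p_k}` with `‖f‖_{U(k)} ≤ 1` is finite. -/
def antiUniformSpace (d k : ℕ) :
    Set (Lp ℝ (sExp k) (volume : Measure (EuclideanSpace ℝ (Fin d)))) :=
  {g | BddAbove (pairingValues k g)}

/-- The closed unit ball of the `k`-th anti-uniform space. -/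
def antiUniformUnitBall (d k : ℕ) :
    Set (Lp ℝ (sExp k) (volume : Measure (EuclideanSpace ℝ (Fin d)))) :=
  {g | g ∈ antiUniformSpace d k ∧ antiUniformNorm k g ≤ 1}

/-- The set `{D_k f : f ∈ L^{p_k}, ‖f‖_{U(k)} ≤ 1}`, as classes in `L^{s_k}`. -/
def dualSet (d k : ℕ) :
    Set (Lp ℝ (sExp k) (volume : Measure (EuclideanSpace ℝ (Fin d)))) :=
  {g | ∃ f : EuclideanSpace ℝ (Fin d) → ℝ,
    MemLp f (pExp k) volume ∧ gowersNorm k f ≤ 1 ∧ g =ᵐ[volume] dualFunction k f}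

end AntiUniform

end

open MeasureTheory
open scoped ENNReal

noncomputable section

namespace AntiUniform

/-! Everything rests on the multilinear form `T(F) = ∫∫ ∏_α F_α(x + α·h) dh dx`, indexed by the
vertices of the cube, and on two bounds for it.

The first is `|T(F)| ≤ ∏ ‖F_α‖_{p_k}` (`lintegral_cubeProd_le`), proved by induction on `k` from
Hölder and Young. It makes all integrals absolutely convergent and gives `‖f‖_{U(k)}^{2^k} = T(f, …,
f)` (`gowersNorm_pow`). Putting `g` at the vertex `0` and `f` elsewhere gives `⟨g, D_k f⟩ = T(g, f,
…, f)` (`integral_mul_dualFunction`), and the converse of Hölder's inequality then places `D_k f` in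
`L^{s_k}`.

The second is Gowers–Cauchy–Schwarz, `|T(F)| ≤ ∏ ‖F_α‖_{U(k)}` (`enorm_cubeForm_le`). It gives `|⟨g,
D_k f⟩| ≤ 1` whenever both norms are at most `1`, so dual functions lie in the unit ball. The ball
is an intersection of closed slabs, hence closed and convex, and so contains the closed convex hull.

Conversely, suppose `g` is in the ball but not in the hull. Hahn–Banach and the representation of
functionals on `L^{s_k}` by `L^{p_k}` give `f` and `u` with `⟨f, D_k f'⟩ < u < ⟨g, f⟩` for all
admissible `f'`. The choice `f' = f/‖f‖_{U(k)}` makes the left side equal to `‖f‖_{U(k)}`, so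
`‖f‖_{U(k)} < u`. Then `f/u` is admissible, whence `⟨g, f⟩ ≤ u`, a contradiction. -/

/-- The real exponent `2^k / (k + 1)`. -/
def pReal (k : ℕ) : ℝ := (2 : ℝ) ^ k / ((k : ℝ) + 1)

theorem pReal_pos (k : ℕ) : 0 < pReal k := by unfold pReal; positivity

theorem inv_pReal (k : ℕ) : (pReal k)⁻¹ = ((k : ℝ) + 1) / 2 ^ k := by
  rw [pReal, inv_div]

/-! ### Cube products and the recursion in the first direction -/

/-- Pairs the two faces of a cube family in the first direction, shifting the upper one by `h`. -/
def pairFamily {d k : ℕ} {R : Type*} [Mul R] (h : EuclideanSpace ℝ (Fin d))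
    (F : (Fin (k + 1) → Bool) → EuclideanSpace ℝ (Fin d) → R) :
    (Fin k → Bool) → EuclideanSpace ℝ (Fin d) → R :=
  fun α x => F (Fin.cons false α) x * F (Fin.cons true α) (x + h)

/-- The product of a family of functions over the vertices of the cube `(x, h)`. -/
def cubeProd {d k : ℕ} {R : Type*} [CommMonoid R]
    (F : (Fin k → Bool) → EuclideanSpace ℝ (Fin d) → R)
    (z : EuclideanSpace ℝ (Fin d) × (Fin k → EuclideanSpace ℝ (Fin d))) : R :=
  ∏ α, F α (z.1 + cubeDot α z.2)

theorem cubeDot_cons {d k : ℕ} (b : Bool) (α : Fin k → Bool) (h₀ : EuclideanSpace ℝ (Fin d))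
    (h : Fin k → EuclideanSpace ℝ (Fin d)) :
    cubeDot (Fin.cons b α : Fin (k + 1) → Bool)
      (Fin.cons h₀ h : Fin (k + 1) → EuclideanSpace ℝ (Fin d)) =
      (if b then h₀ else 0) + cubeDot α h := by
  simp [cubeDot, Fin.sum_univ_succ]

theorem prod_cube_succ {k : ℕ} {R : Type*} [CommMonoid R] (φ : (Fin (k + 1) → Bool) → R) :
    ∏ α, φ α = ∏ α : Fin k → Bool, φ (Fin.cons false α) * φ (Fin.cons true α) := by
  rw [← (Fin.consEquiv (fun _ : Fin (k + 1) => Bool)).prod_comp, Fintype.prod_prod_type,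
    Fintype.prod_bool, mul_comm, Finset.prod_mul_distrib]
  rfl

theorem cubeProd_cons {d k : ℕ} {R : Type*} [CommMonoid R]
    (F : (Fin (k + 1) → Bool) → EuclideanSpace ℝ (Fin d) → R)
    (x h₀ : EuclideanSpace ℝ (Fin d)) (h : Fin k → EuclideanSpace ℝ (Fin d)) :
    cubeProd F (x, Fin.cons h₀ h) = cubeProd (pairFamily h₀ F) (x, h) := by
  simp only [cubeProd, pairFamily, prod_cube_succ, cubeDot_cons]
  refine Finset.prod_congr rfl fun α _ => ?_
  simp [add_assoc, add_comm h₀]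

theorem measurable_cubeDot {d k : ℕ} (α : Fin k → Bool) :
    Measurable (cubeDot α : (Fin k → EuclideanSpace ℝ (Fin d)) → EuclideanSpace ℝ (Fin d)) := by
  unfold cubeDot
  refine Finset.measurable_sum _ fun i _ => ?_
  split_ifs
  · exact measurable_pi_apply i
  · exact measurable_const

theorem measurable_cubeProd {d k : ℕ} {R : Type*} [CommMonoid R] [MeasurableSpace R]
    [MeasurableMul₂ R] {F : (Fin k → Bool) → EuclideanSpace ℝ (Fin d) → R}
    (hF : ∀ α, Measurable (F α)) : Measurable (cubeProd F) := by
  unfold cubeProd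
  refine Finset.measurable_prod _ fun α _ => (hF α).comp ?_
  exact measurable_fst.add ((measurable_cubeDot α).comp measurable_snd)

theorem measurable_pairFamily {d k : ℕ} {R : Type*} [Mul R] [MeasurableSpace R]
    [MeasurableMul₂ R] {F : (Fin (k + 1) → Bool) → EuclideanSpace ℝ (Fin d) → R}
    (hF : ∀ α, Measurable (F α)) (h : EuclideanSpace ℝ (Fin d)) (α : Fin k → Bool) :
    Measurable (pairFamily h F α) :=
  (hF _).mul ((hF _).comp (measurable_id.add_const h))

/-- Singles out the first difference parameter of a cube. -/
def cubeEquiv (d k : ℕ) :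
    EuclideanSpace ℝ (Fin d) × EuclideanSpace ℝ (Fin d) × (Fin k → EuclideanSpace ℝ (Fin d)) ≃ᵐ
      EuclideanSpace ℝ (Fin d) × (Fin (k + 1) → EuclideanSpace ℝ (Fin d)) :=
  ((MeasurableEquiv.prodAssoc.symm.trans
    (MeasurableEquiv.prodComm.prodCongr (MeasurableEquiv.refl _))).trans
      MeasurableEquiv.prodAssoc).trans
        ((MeasurableEquiv.refl _).prodCongr
          (MeasurableEquiv.piFinSuccAbove (fun _ : Fin (k + 1) => EuclideanSpace ℝ (Fin d)) 0).symm)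

theorem cubeEquiv_apply {d k : ℕ} (h₀ x : EuclideanSpace ℝ (Fin d))
    (h : Fin k → EuclideanSpace ℝ (Fin d)) : cubeEquiv d k (h₀, x, h) = (x, Fin.cons h₀ h) := by
  simp [cubeEquiv, MeasurableEquiv.prodAssoc, MeasurableEquiv.prodComm,
    MeasurableEquiv.prodCongr, MeasurableEquiv.piFinSuccAbove, Fin.insertNthEquiv]

theorem measurePreserving_cubeEquiv (d k : ℕ) : MeasurePreserving (cubeEquiv d k) := by
  have h1 := (measurePreserving_prodAssoc (volume : Measure (EuclideanSpace ℝ (Fin d)))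
    (volume : Measure (EuclideanSpace ℝ (Fin d)))
    (volume : Measure (Fin k → EuclideanSpace ℝ (Fin d))))
  have h2 : MeasurePreserving
      (MeasurableEquiv.prodComm.prodCongr (MeasurableEquiv.refl (Fin k → EuclideanSpace ℝ (Fin d))))
      (((volume : Measure (EuclideanSpace ℝ (Fin d))).prod
        (volume : Measure (EuclideanSpace ℝ (Fin d)))).prod volume)
      (((volume : Measure (EuclideanSpace ℝ (Fin d))).prod
        (volume : Measure (EuclideanSpace ℝ (Fin d)))).prod volume) :=
    (Measure.measurePreserving_swap).prod (MeasurePreserving.id _)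
  have h3 : MeasurePreserving ((MeasurableEquiv.refl (EuclideanSpace ℝ (Fin d))).prodCongr
      (MeasurableEquiv.piFinSuccAbove (fun _ : Fin (k + 1) => EuclideanSpace ℝ (Fin d)) 0).symm) :=
    (MeasurePreserving.id _).prod
      ((volume_preserving_piFinSuccAbove
        (fun _ : Fin (k + 1) => EuclideanSpace ℝ (Fin d)) 0).symm _)
  exact h3.comp (h1.comp (h2.comp (h1.symm _)))

theorem cubeProd_cubeEquiv {d k : ℕ} {R : Type*} [CommMonoid R]
    (F : (Fin (k + 1) → Bool) → EuclideanSpace ℝ (Fin d) → R)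
    (w : EuclideanSpace ℝ (Fin d) × EuclideanSpace ℝ (Fin d) ×
      (Fin k → EuclideanSpace ℝ (Fin d))) :
    cubeProd F (cubeEquiv d k w) = cubeProd (pairFamily w.1 F) w.2 := by
  obtain ⟨h₀, x, h⟩ := w
  rw [cubeEquiv_apply, cubeProd_cons]

/-- Tonelli with the first difference outermost; this drives the induction on the dimension of the
cube. -/
theorem lintegral_cubeProd_succ {d k : ℕ}
    {F : (Fin (k + 1) → Bool) → EuclideanSpace ℝ (Fin d) → ℝ≥0∞} (hF : ∀ α, Measurable (F α)) :
    ∫⁻ z, cubeProd F z = ∫⁻ h, ∫⁻ z, cubeProd (pairFamily h F) z := by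
  rw [← (measurePreserving_cubeEquiv d k).lintegral_comp (measurable_cubeProd hF),
    Measure.volume_eq_prod, lintegral_prod]
  · simp_rw [cubeProd_cubeEquiv]
  · exact ((measurable_cubeProd hF).comp (cubeEquiv d k).measurable).aemeasurable

/-! ### Young's inequality and the `L^{p_k}` bound -/

theorem rpow_mul_rpow_eq {a : ℝ≥0∞} {x y z : ℝ} (hx : 0 ≤ x) (hy : 0 ≤ y) (h : x + y = z) :
    a ^ x * a ^ y = a ^ z := by
  rw [← ENNReal.rpow_add_of_nonneg _ _ hx hy, h]

/-- Young's inequality for the correlation of two functions, with output exponent `n`. -/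
theorem lintegral_correlation_pow_le {d n : ℕ} (hn : 1 ≤ n)
    {A B : EuclideanSpace ℝ (Fin d) → ℝ≥0∞} (hA : Measurable A) (hB : Measurable B) :
    ∫⁻ h, (∫⁻ x, A x * B (x + h)) ^ n ≤
      (∫⁻ x, A x ^ (2 * n / (n + 1) : ℝ)) ^ ((n + 1) / 2 : ℝ) *
        (∫⁻ x, B x ^ (2 * n / (n + 1) : ℝ)) ^ ((n + 1) / 2 : ℝ) := by
  -- Young's exponent: `2/q = 1 + 1/n`. Below, `c` is fixed by `1/n + 2c = 1`, the weights in a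
  -- three-factor Hölder inequality.
  set q : ℝ := 2 * n / (n + 1) with hq
  have hn' : (1 : ℝ) ≤ n := by exact_mod_cast hn
  have hn0 : (n : ℝ) ≠ 0 := by positivity
  have hqpos : 0 < q := by positivity
  set c : ℝ := (n - 1) / (2 * n) with hc
  have hc0 : 0 ≤ c := div_nonneg (by linarith) (by positivity)
  have hqn : 0 ≤ q * (1 / n) := by positivity
  have hqc : q * (1 / n) + q * c = 1 := by rw [hq, hc]; field_simp; ring
  have hAq : Measurable fun x => A x ^ q := hA.pow_const q
  have hBq : Measurable fun x => B x ^ q := hB.pow_const q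
  -- Hölder for `A B(·+h) = (A^q B(·+h)^q)^{1/n} (A^q)^c (B(·+h)^q)^c`, raised to the power `n`. By
  -- translation invariance only the first factor still depends on `h`, and Tonelli splits its
  -- integral over `h`.
  have key : ∀ h, (∫⁻ x, A x * B (x + h)) ^ n ≤
      (∫⁻ x, A x ^ q * B (x + h) ^ q) *
        ((∫⁻ x, A x ^ q) ^ ((n - 1) / 2 : ℝ) * (∫⁻ x, B x ^ q) ^ ((n - 1) / 2 : ℝ)) := by
    intro h
    have hBh : Measurable fun x => B (x + h) := hB.comp (measurable_id.add_const h)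
    have holder := ENNReal.lintegral_prod_norm_pow_le
      (μ := (volume : Measure (EuclideanSpace ℝ (Fin d)))) (Finset.univ : Finset (Fin 3))
      (f := ![fun x => A x ^ q * B (x + h) ^ q, fun x => A x ^ q, fun x => B (x + h) ^ q])
      (p := ![1 / n, c, c]) (by
        intro i _
        fin_cases i
        · exact (hAq.mul (hBh.pow_const q)).aemeasurable
        · exact hAq.aemeasurable
        · exact (hBh.pow_const q).aemeasurable) (by
        simp only [Fin.sum_univ_three, Matrix.cons_val]
        rw [hc]; field_simp; ring) (by
        intro i _
        fin_cases i
        · simp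
        · exact hc0
        · exact hc0)
    simp only [Fin.prod_univ_three, Matrix.cons_val] at holder
    have hpt : ∀ x, (A x ^ q * B (x + h) ^ q) ^ (1 / n : ℝ) * (A x ^ q) ^ c * (B (x + h) ^ q) ^ c
        = A x * B (x + h) := by
      intro x
      rw [ENNReal.mul_rpow_of_nonneg _ _ (by positivity)]
      simp only [← ENNReal.rpow_mul]
      calc _ = (A x ^ (q * (1 / n)) * A x ^ (q * c)) *
            (B (x + h) ^ (q * (1 / n)) * B (x + h) ^ (q * c)) := by ring
        _ = _ := by
          rw [rpow_mul_rpow_eq hqn (by positivity) hqc, rpow_mul_rpow_eq hqn (by positivity) hqc,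
            ENNReal.rpow_one, ENNReal.rpow_one]
    simp only [hpt] at holder
    rw [lintegral_add_right_eq_self (fun x => B x ^ q) h] at holder
    refine (pow_le_pow_left' holder n).trans (le_of_eq ?_)
    rw [mul_pow, mul_pow, mul_assoc]
    simp only [← ENNReal.rpow_natCast, ← ENNReal.rpow_mul]
    have e1 : (1 : ℝ) / n * n = 1 := by field_simp
    have e2 : c * n = (n - 1) / 2 := by rw [hc]; field_simp
    rw [e1, e2, ENNReal.rpow_one]
  refine (lintegral_mono key).trans (le_of_eq ?_)
  have hm : Measurable fun w : EuclideanSpace ℝ (Fin d) × EuclideanSpace ℝ (Fin d) =>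
      A w.2 ^ q * B (w.2 + w.1) ^ q :=
    (hAq.comp measurable_snd).mul (hBq.comp (measurable_snd.add measurable_fst))
  rw [lintegral_mul_const _ hm.lintegral_prod_right', lintegral_lintegral_swap hm.aemeasurable]
  have hin : ∀ x, ∫⁻ h, A x ^ q * B (x + h) ^ q = A x ^ q * ∫⁻ h, B h ^ q := by
    intro x
    rw [lintegral_const_mul _ (f := fun h => B (x + h) ^ q)
      (hBq.comp (measurable_id.const_add x)), lintegral_add_left_eq_self (fun y => B y ^ q) x]
  simp only [hin]
  rw [lintegral_mul_const _ hAq]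
  have hn2 : (0 : ℝ) ≤ (n - 1) / 2 := by linarith
  have e : (1 : ℝ) + (n - 1) / 2 = (n + 1) / 2 := by ring
  rw [← rpow_mul_rpow_eq (a := ∫⁻ x, A x ^ q) zero_le_one hn2 e,
    ← rpow_mul_rpow_eq (a := ∫⁻ x, B x ^ q) zero_le_one hn2 e, ENNReal.rpow_one, ENNReal.rpow_one]
  ring

/-- Young for `F^{p_k}` and `G^{p_k}` with `n = k + 1`. The identity `p_k · 2(k+1)/(k+2) = p_{k+1}`
is what fits the exponents to the induction on the cube. -/
theorem lintegral_pair_rpow_pow_le {d : ℕ} (k : ℕ)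
    {F G : EuclideanSpace ℝ (Fin d) → ℝ≥0∞} (hF : Measurable F) (hG : Measurable G) :
    ∫⁻ h, (∫⁻ x, (F x * G (x + h)) ^ pReal k) ^ (k + 1) ≤
      (∫⁻ x, F x ^ pReal (k + 1)) ^ (((k + 1 : ℕ) + 1 : ℝ) / 2) *
        (∫⁻ x, G x ^ pReal (k + 1)) ^ (((k + 1 : ℕ) + 1 : ℝ) / 2) := by
  have h := lintegral_correlation_pow_le (n := k + 1) (by omega) (hF.pow_const (pReal k))
    (hG.pow_const (pReal k))
  have e : pReal k * (2 * (k + 1 : ℕ) / ((k + 1 : ℕ) + 1)) = pReal (k + 1) := by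
    unfold pReal; push_cast; field_simp; ring
  simp only [← ENNReal.rpow_mul, e, ← ENNReal.mul_rpow_of_nonneg _ _ (pReal_pos k).le] at h
  exact h

theorem lintegral_cube_zero {d : ℕ} (φ : EuclideanSpace ℝ (Fin d) ×
    (Fin 0 → EuclideanSpace ℝ (Fin d)) → ℝ≥0∞) (hφ : Measurable φ) :
    ∫⁻ z, φ z = ∫⁻ x, φ (x, isEmptyElim) := by
  rw [Measure.volume_eq_prod, lintegral_prod _ hφ.aemeasurable, Measure.volume_pi_eq_dirac]
  refine lintegral_congr fun x => ?_
  rw [lintegral_dirac' _ (by fun_prop)]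

/-- The multilinear Gowers form is bounded on `L^{p_k}`. -/
theorem lintegral_cubeProd_le {d k : ℕ}
    {F : (Fin k → Bool) → EuclideanSpace ℝ (Fin d) → ℝ≥0∞} (hF : ∀ α, Measurable (F α)) :
    ∫⁻ z, cubeProd F z ≤ ∏ α, (∫⁻ x, F α x ^ pReal k) ^ (pReal k)⁻¹ := by
  induction k with
  | zero =>
    rw [lintegral_cube_zero _ (measurable_cubeProd hF)]
    simp [cubeProd, pReal, cubeDot]
  | succ k ih =>
    rw [lintegral_cubeProd_succ hF]
    have hm : ∀ α : Fin k → Bool, Measurable fun h : EuclideanSpace ℝ (Fin d) =>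
        (∫⁻ x, pairFamily h F α x ^ pReal k) ^ (k + 1) := by
      intro α
      refine Measurable.pow_const ?_ _
      refine Measurable.lintegral_prod_right' (f := fun w : EuclideanSpace ℝ (Fin d) ×
        EuclideanSpace ℝ (Fin d) => pairFamily w.1 F α w.2 ^ pReal k) ?_
      refine Measurable.pow_const ?_ _
      exact ((hF _).comp measurable_snd).mul ((hF _).comp (measurable_snd.add measurable_fst))
    -- Since `1/p_k = (k+1)/2^k`, each factor is a `(k+1)`-st power raised to `1/2^k`. Hölder over
    -- the `2^k` vertices uses the equal weights, leaving the power `k + 1` for Young.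
    calc ∫⁻ h, ∫⁻ z, cubeProd (pairFamily h F) z
        ≤ ∫⁻ h, ∏ α, (∫⁻ x, pairFamily h F α x ^ pReal k) ^ (pReal k)⁻¹ :=
          lintegral_mono fun h => ih (measurable_pairFamily hF h)
      _ = ∫⁻ h, ∏ α : Fin k → Bool,
            ((∫⁻ x, pairFamily h F α x ^ pReal k) ^ (k + 1)) ^ ((1 : ℝ) / 2 ^ k) := by
          refine lintegral_congr fun h => Finset.prod_congr rfl fun α _ => ?_
          rw [← ENNReal.rpow_natCast, ← ENNReal.rpow_mul, inv_pReal]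
          congr 1
          push_cast; ring
      _ ≤ ∏ α : Fin k → Bool,
            (∫⁻ h, (∫⁻ x, pairFamily h F α x ^ pReal k) ^ (k + 1)) ^ ((1 : ℝ) / 2 ^ k) := by
          refine ENNReal.lintegral_prod_norm_pow_le _ (fun α _ => (hm α).aemeasurable) ?_ ?_
          · simp
          · intros; positivity
      _ ≤ ∏ α : Fin k → Bool, ((∫⁻ x, F (Fin.cons false α) x ^ pReal (k + 1)) ^ (pReal (k + 1))⁻¹ *
            (∫⁻ x, F (Fin.cons true α) x ^ pReal (k + 1)) ^ (pReal (k + 1))⁻¹) := by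
          refine Finset.prod_le_prod' fun α _ => ?_
          refine (ENNReal.rpow_le_rpow (lintegral_pair_rpow_pow_le k (hF _) (hF _))
            (by positivity)).trans (le_of_eq ?_)
          rw [ENNReal.mul_rpow_of_nonneg _ _ (by positivity), ← ENNReal.rpow_mul,
            ← ENNReal.rpow_mul, inv_pReal]
          have e : (((k + 1 : ℕ) : ℝ) + 1) / 2 * (1 / 2 ^ k) =
              (((k + 1 : ℕ) : ℝ) + 1) / 2 ^ (k + 1) := by
            field_simp; ring
          rw [e]
      _ = _ := (prod_cube_succ
          (fun α => (∫⁻ x, F α x ^ pReal (k + 1)) ^ (pReal (k + 1))⁻¹)).symm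

/-! ### Duality of Lebesgue spaces -/

/-- The converse of Hölder's inequality, tested on functions dominated by multiples of a weight. -/
theorem lintegral_rpow_le_of_forall_lintegral_mul_le {α : Type*} [MeasurableSpace α]
    {μ : Measure α} {p q : ℝ} (hpq : p.HolderConjugate q) {S w : α → ℝ≥0∞} (hS : Measurable S)
    (hw : Measurable w) (hw0 : ∀ x, w x ≠ 0) (hwp : ∫⁻ x, w x ^ p ∂μ ≠ ∞) {C : ℝ≥0∞}
    (h : ∀ u : α → ℝ≥0∞, Measurable u → (∃ n : ℕ, ∀ x, u x ≤ n * w x) →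
      ∫⁻ x, u x * S x ∂μ ≤ C * (∫⁻ x, u x ^ p ∂μ) ^ (1 / p)) :
    ∫⁻ x, S x ^ q ∂μ ≤ C ^ q := by
  have hp0 : 0 < p := hpq.pos
  have hq0 : 0 < q := hpq.symm.pos
  have hp1 : 0 ≤ p - 1 := hpq.sub_one_pos.le
  have hq1 : 0 ≤ q - 1 := hpq.symm.sub_one_pos.le
  -- The Hölder extremiser `S^(q-1)`, truncated by a multiple of the weight so that its `p`-th power
  -- has finite integral.
  set u : ℕ → α → ℝ≥0∞ := fun n x => min (S x ^ (q - 1)) (n * w x) with hu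
  have hum : ∀ n, Measurable (u n) := fun n =>
    (hS.pow_const _).min (measurable_const.mul hw)
  have hexp : (q - 1) * (p - 1) = 1 := by
    have := hpq.symm.sub_one_mul_conj
    linarith
  have hle : ∀ n x, u n x ^ p ≤ u n x * S x := by
    intro n x
    have : u n x ^ (p - 1) ≤ S x := by
      calc u n x ^ (p - 1) ≤ (S x ^ (q - 1)) ^ (p - 1) :=
            ENNReal.rpow_le_rpow (min_le_left _ _) hp1
        _ = S x := by rw [← ENNReal.rpow_mul, hexp, ENNReal.rpow_one]
    calc u n x ^ p = u n x ^ (1 : ℝ) * u n x ^ (p - 1) :=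
          (rpow_mul_rpow_eq zero_le_one hp1 (by ring)).symm
      _ ≤ u n x * S x := by rw [ENNReal.rpow_one]; gcongr
  have hbound : ∀ n, ∫⁻ x, u n x ^ p ∂μ ≤ C ^ q := by
    intro n
    set I := ∫⁻ x, u n x ^ p ∂μ with hI
    have hIfin : I ≠ ∞ := by
      refine ne_top_of_le_ne_top (ENNReal.mul_ne_top (a := (n : ℝ≥0∞) ^ p)
        (ENNReal.rpow_ne_top_of_nonneg hp0.le (ENNReal.natCast_ne_top n)) hwp) ?_
      rw [← lintegral_const_mul _ (hw.pow_const p)]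
      refine lintegral_mono fun x => ?_
      rw [← ENNReal.mul_rpow_of_nonneg _ _ hp0.le]
      exact ENNReal.rpow_le_rpow (min_le_right _ _) hp0.le
    have h1 : I ≤ C * I ^ (1 / p) :=
      (lintegral_mono fun x => hle n x).trans (h (u n) (hum n) ⟨n, fun x => min_le_right _ _⟩)
    have hsplit : I ^ (1 / q) * I ^ (1 / p) = I := by
      rw [rpow_mul_rpow_eq (z := 1) (by positivity) (by positivity), ENNReal.rpow_one]
      have := hpq.inv_add_inv_eq_one
      simp only [one_div]
      linarith
    -- Truncation makes `I` finite, so `I ≤ C I^{1/p}` may be divided by `I^{1/p}`.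
    by_contra hlt
    push Not at hlt
    have hlt2 : C < I ^ (1 / q) := by
      have := ENNReal.rpow_lt_rpow hlt (show 0 < 1 / q by positivity)
      rwa [← ENNReal.rpow_mul, mul_one_div_cancel hq0.ne', ENNReal.rpow_one] at this
    have hI0 : I ≠ 0 := (bot_le.trans_lt hlt).ne'
    have hIp0 : I ^ (1 / p) ≠ 0 := by simp [hI0, hIfin]
    have hIpt : I ^ (1 / p) ≠ ∞ := ENNReal.rpow_ne_top_of_nonneg (by positivity) hIfin
    have := (ENNReal.mul_lt_mul_iff_left hIp0 hIpt).2 hlt2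
    rw [hsplit] at this
    exact absurd h1 (not_le.2 this)
  have hlim : Filter.Tendsto (fun n => ∫⁻ x, u n x ^ p ∂μ) Filter.atTop
      (nhds (∫⁻ x, S x ^ q ∂μ)) := by
    refine lintegral_tendsto_of_tendsto_of_monotone
      (fun n => ((hum n).pow_const p).aemeasurable) (ae_of_all _ fun x m n hmn => ?_)
      (ae_of_all _ fun x => ?_)
    · refine ENNReal.rpow_le_rpow (min_le_min le_rfl ?_) hp0.le
      gcongr
    · have h1 : Filter.Tendsto (fun n : ℕ => (n : ℝ≥0∞) * w x) Filter.atTop (nhds ∞) := by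
        have := ENNReal.Tendsto.mul_const (b := w x) ENNReal.tendsto_nat_nhds_top
          (Or.inl ENNReal.top_ne_zero)
        rwa [ENNReal.top_mul (hw0 x)] at this
      have h2 : Filter.Tendsto (fun n : ℕ => u n x) Filter.atTop (nhds (S x ^ (q - 1))) := by
        have := (tendsto_const_nhds (x := S x ^ (q - 1))).min h1
        rwa [min_eq_left le_top] at this
      have h3 := (ENNReal.continuous_rpow_const (y := p)).continuousAt.tendsto.comp h2
      rw [← ENNReal.rpow_mul, hpq.symm.sub_one_mul_conj] at h3
      exact h3
  exact le_of_tendsto' hlim hbound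

/-- A strictly positive `L^p` function replaces the constant `1`, which need not be in `L^p` when
the measure is infinite. -/
theorem exists_pos_weight {α : Type*} [MeasurableSpace α] (μ : Measure α) [SigmaFinite μ]
    {p : ℝ} (hp : 0 < p) :
    ∃ w : α → NNReal, Measurable w ∧ (∀ x, 0 < w x) ∧ ∫⁻ x, (w x : ℝ≥0∞) ^ p ∂μ ≠ ∞ := by
  obtain ⟨g, hg0, hgm, hg⟩ := exists_pos_lintegral_lt_of_sigmaFinite μ (one_ne_zero)
  refine ⟨fun x => g x ^ (1 / p), hgm.pow_const _, fun x => NNReal.rpow_pos (hg0 x), ?_⟩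
  refine ne_top_of_lt (b := 1) (lt_of_le_of_lt (le_of_eq ?_) hg)
  refine lintegral_congr fun x => ?_
  rw [← ENNReal.coe_rpow_of_nonneg _ hp.le, ← NNReal.rpow_mul, one_div_mul_cancel hp.ne', NNReal.rpow_one]

theorem memLp_ofReal_iff {α : Type*} [MeasurableSpace α] {μ : Measure α} {p : ℝ} (hp : 0 < p)
    {f : α → ℝ} (hf : AEStronglyMeasurable f μ) :
    MemLp f (ENNReal.ofReal p) μ ↔ ∫⁻ x, ‖f x‖ₑ ^ p ∂μ < ∞ := by
  have h := eLpNorm_lt_top_iff_lintegral_rpow_enorm_lt_top (f := f) (μ := μ)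
    (p := ENNReal.ofReal p) (by simpa using hp) ENNReal.ofReal_ne_top
  rw [ENNReal.toReal_ofReal hp.le] at h
  exact ⟨fun hm => h.1 hm.2, fun hl => ⟨hf, h.2 hl⟩⟩

/-- Dominated convergence in `L^p`. -/
theorem tendsto_toLp_of_dominated {α ι : Type*} [MeasurableSpace α] {μ : Measure α} {p : ℝ}
    (hp : 0 < p) [Fact (1 ≤ ENNReal.ofReal p)] {l : Filter ι} [l.IsCountablyGenerated]
    {F : ι → α → ℝ} {f G : α → ℝ}
    (hF : ∀ n, MemLp (F n) (ENNReal.ofReal p) μ) (hf : MemLp f (ENNReal.ofReal p) μ)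
    (hG : MemLp G (ENNReal.ofReal p) μ) (hFm : ∀ n, Measurable (F n)) (hfm : Measurable f)
    (hFG : ∀ n x, |F n x| ≤ G x) (hfG : ∀ x, |f x| ≤ G x)
    (hlim : ∀ x, Filter.Tendsto (fun n => F n x) l (nhds (f x))) :
    Filter.Tendsto (fun n => (hF n).toLp (F n)) l (nhds (hf.toLp f)) := by
  rw [Lp.tendsto_Lp_iff_tendsto_eLpNorm'']
  simp only [eLpNorm_eq_lintegral_rpow_enorm_toReal (p := ENNReal.ofReal p) (by simpa using hp)
    ENNReal.ofReal_ne_top, ENNReal.toReal_ofReal hp.le]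
  have key : Filter.Tendsto (fun n => ∫⁻ x, ‖(F n - f) x‖ₑ ^ p ∂μ) l
      (nhds (∫⁻ x, (0 : ℝ≥0∞) ∂μ)) := by
    refine tendsto_lintegral_filter_of_dominated_convergence
      (fun x => (2 : ℝ≥0∞) ^ p * ‖G x‖ₑ ^ p) ?_ ?_ ?_ ?_
    · exact Filter.Eventually.of_forall fun n => (((hFm n).sub hfm).enorm).pow_const p
    · refine Filter.Eventually.of_forall fun n => ae_of_all _ fun x => ?_
      rw [← ENNReal.mul_rpow_of_nonneg _ _ hp.le]
      refine ENNReal.rpow_le_rpow ?_ hp.le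
      have h2 : (2 : ℝ≥0∞) * ‖G x‖ₑ = ENNReal.ofReal (2 * |G x|) := by
        rw [ENNReal.ofReal_mul (by norm_num), Real.enorm_eq_ofReal_abs]
        norm_num
      rw [h2, Real.enorm_eq_ofReal_abs]
      refine ENNReal.ofReal_le_ofReal ?_
      have a := hFG n x
      have b := hfG x
      have c := abs_sub (F n x) (f x)
      have e := le_abs_self (G x)
      simp only [Pi.sub_apply]
      linarith
    · rw [lintegral_const_mul' _ _ (ENNReal.rpow_ne_top_of_nonneg hp.le (by norm_num))]
      exact ENNReal.mul_ne_top (ENNReal.rpow_ne_top_of_nonneg hp.le (by norm_num))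
        ((memLp_ofReal_iff hp hG.1).1 hG).ne
    · refine ae_of_all _ fun x => ?_
      have h1 : Filter.Tendsto (fun n => (F n - f) x) l (nhds 0) := by
        simpa using (hlim x).sub_const (f x)
      have h2 := ((ENNReal.continuous_rpow_const (y := p)).comp
        continuous_enorm).tendsto (0 : ℝ) |>.comp h1
      simpa [Function.comp_def, hp] using h2
  have h3 := (ENNReal.continuous_rpow_const (y := 1 / p)).continuousAt.tendsto.comp key
  simpa [Function.comp_def, hp] using h3

theorem memLp_mul_of_bounded {α : Type*} [MeasurableSpace α] {μ : Measure α} {p : ℝ≥0∞}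
    {W b : α → ℝ} (hW : MemLp W p μ) (hb : Measurable b) {c : ℝ} (hbc : ∀ x, |b x| ≤ c) :
    MemLp (fun x => b x * W x) p μ := by
  refine MemLp.of_le_mul (c := c) hW (hb.aestronglyMeasurable.mul hW.1) (ae_of_all _ fun x => ?_)
  rw [norm_mul]
  exact mul_le_mul_of_nonneg_right (hbc x) (norm_nonneg _)

/-- A functional on `L^p` evaluated at a function, with value `0` off `L^p`. -/
def evalFun {α : Type*} [MeasurableSpace α] {μ : Measure α} {p : ℝ≥0∞} [Fact (1 ≤ p)]
    (Λ : Lp ℝ p μ →L[ℝ] ℝ) (u : α → ℝ) : ℝ :=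
  open Classical in if h : MemLp u p μ then Λ (h.toLp u) else 0

theorem evalFun_eq {α : Type*} [MeasurableSpace α] {μ : Measure α} {p : ℝ≥0∞} [Fact (1 ≤ p)]
    (Λ : Lp ℝ p μ →L[ℝ] ℝ) {u : α → ℝ} (h : MemLp u p μ) : evalFun Λ u = Λ (h.toLp u) := by
  simp [evalFun, h]

theorem evalFun_congr_ae {α : Type*} [MeasurableSpace α] {μ : Measure α} {p : ℝ≥0∞}
    [Fact (1 ≤ p)] (Λ : Lp ℝ p μ →L[ℝ] ℝ) {u v : α → ℝ} (hu : MemLp u p μ) (h : u =ᵐ[μ] v) :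
    evalFun Λ u = evalFun Λ v := by
  rw [evalFun_eq Λ hu, evalFun_eq Λ (hu.ae_eq h)]
  congr 1
  exact (MemLp.toLp_eq_toLp_iff _ _).2 h

theorem evalFun_add {α : Type*} [MeasurableSpace α] {μ : Measure α} {p : ℝ≥0∞} [Fact (1 ≤ p)]
    (Λ : Lp ℝ p μ →L[ℝ] ℝ) {u v : α → ℝ} (hu : MemLp u p μ) (hv : MemLp v p μ) :
    evalFun Λ (fun x => u x + v x) = evalFun Λ u + evalFun Λ v := by
  rw [evalFun_eq Λ hu, evalFun_eq Λ hv, evalFun_eq Λ (u := fun x => u x + v x) (hu.add hv),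
    ← map_add]
  rfl

theorem evalFun_const_mul {α : Type*} [MeasurableSpace α] {μ : Measure α} {p : ℝ≥0∞}
    [Fact (1 ≤ p)] (Λ : Lp ℝ p μ →L[ℝ] ℝ) {u : α → ℝ} (hu : MemLp u p μ) (c : ℝ) :
    evalFun Λ (fun x => c * u x) = c * evalFun Λ u := by
  rw [evalFun_eq Λ hu, evalFun_eq Λ (u := fun x => c * u x) (hu.const_mul c), ← smul_eq_mul,
    ← map_smul]
  rfl

theorem evalFun_sum {α ι : Type*} [MeasurableSpace α] {μ : Measure α} {p : ℝ≥0∞}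
    [Fact (1 ≤ p)] (Λ : Lp ℝ p μ →L[ℝ] ℝ) {u : ι → α → ℝ} (hu : ∀ i, MemLp (u i) p μ)
    (s : Finset ι) : evalFun Λ (fun x => ∑ i ∈ s, u i x) = ∑ i ∈ s, evalFun Λ (u i) := by
  classical
  induction s using Finset.induction with
  | empty =>
    have := evalFun_const_mul Λ (MemLp.zero (α := α) (μ := μ) (p := p) (ε := ℝ)) 0
    simpa using this
  | insert i s hi ih =>
    simp only [Finset.sum_insert hi]
    rw [evalFun_add Λ (hu i) (memLp_finsetSum s fun j _ => hu j), ih]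

/-- The filter is kept general: countable additivity below is a limit along finite subsets of `ℕ`,
while the approximation arguments use sequences. -/
theorem tendsto_evalFun_of_dominated {α ι : Type*} [MeasurableSpace α] {μ : Measure α} {p : ℝ}
    (hp : 0 < p) [Fact (1 ≤ ENNReal.ofReal p)] (Λ : Lp ℝ (ENNReal.ofReal p) μ →L[ℝ] ℝ)
    {l : Filter ι} [l.IsCountablyGenerated] {F : ι → α → ℝ} {f G : α → ℝ}
    (hG : MemLp G (ENNReal.ofReal p) μ) (hFm : ∀ n, Measurable (F n)) (hfm : Measurable f)
    (hFG : ∀ n x, |F n x| ≤ G x) (hfG : ∀ x, |f x| ≤ G x)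
    (hlim : ∀ x, Filter.Tendsto (fun n => F n x) l (nhds (f x))) :
    Filter.Tendsto (fun n => evalFun Λ (F n)) l (nhds (evalFun Λ f)) := by
  have hF : ∀ n, MemLp (F n) (ENNReal.ofReal p) μ := fun n =>
    hG.mono (hFm n).aestronglyMeasurable (ae_of_all _ fun x => (hFG n x).trans (le_abs_self _))
  have hf : MemLp f (ENNReal.ofReal p) μ :=
    hG.mono hfm.aestronglyMeasurable (ae_of_all _ fun x => (hfG x).trans (le_abs_self _))
  simp only [evalFun_eq Λ (hF _), evalFun_eq Λ hf]
  exact (Λ.continuous.tendsto _).comp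
    (tendsto_toLp_of_dominated hp hF hf hG hFm hfm hFG hfG hlim)

/-- A functional on `L^p`, restricted to indicators multiplied by a weight, as a signed measure. -/
def weightedMeasure {α : Type*} [MeasurableSpace α] {μ : Measure α} {p : ℝ}
    (hp : 0 < p) [Fact (1 ≤ ENNReal.ofReal p)] (Λ : Lp ℝ (ENNReal.ofReal p) μ →L[ℝ] ℝ)
    {W : α → ℝ} (hW : MemLp W (ENNReal.ofReal p) μ) (hWm : Measurable W) (hW0 : ∀ x, 0 < W x) :
    SignedMeasure α where
  measureOf' A := open Classical in if MeasurableSet A then evalFun Λ (A.indicator W) else 0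
  empty' := by
    have := evalFun_const_mul Λ (MemLp.zero (α := α) (μ := μ) (p := ENNReal.ofReal p) (ε := ℝ)) 0
    simp only [MeasurableSet.empty, if_true, Set.indicator_empty]
    simpa using this
  not_measurable' A hA := by simp [hA]
  m_iUnion' f hfm hfd := by
    simp only [hfm, MeasurableSet.iUnion hfm, if_true]
    have hpos : ∀ (A : Set α) x, |A.indicator W x| ≤ W x := fun A x => by
      rw [abs_of_nonneg (Set.indicator_nonneg (fun y _ => (hW0 y).le) x)]
      exact Set.indicator_le_self' (fun y _ => (hW0 y).le) x
    have hmem : ∀ i, MemLp ((f i).indicator W) (ENNReal.ofReal p) μ := fun i =>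
      hW.indicator (hfm i)
    have hsum : ∀ (s : Finset ℕ) x, ∑ i ∈ s, (f i).indicator W x =
        (⋃ i ∈ s, f i).indicator W x := fun s x => by
      rw [Finset.indicator_biUnion s f (fun i _ j _ hij => hfd hij)]
    unfold HasSum
    simp only [← evalFun_sum Λ hmem]
    -- Partial sums are `W` times indicators of partial unions, so `W` dominates them all.
    refine tendsto_evalFun_of_dominated hp Λ hW
      (fun s => Finset.measurable_sum _ fun i _ => hWm.indicator (hfm i))
      (hWm.indicator (MeasurableSet.iUnion hfm)) (fun s x => ?_) (hpos _) (fun x => ?_)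
    · rw [hsum]; exact hpos _ x
    · by_cases hx : x ∈ ⋃ i, f i
      · obtain ⟨j, hj⟩ := Set.mem_iUnion.1 hx
        rw [Set.indicator_of_mem hx, ← Set.indicator_of_mem hj W]
        refine hasSum_single j fun i hij => Set.indicator_of_notMem (fun hi => ?_) _
        exact Set.disjoint_left.1 (hfd hij) hi hj
      · rw [Set.indicator_of_notMem hx]
        have : ∀ i, (f i).indicator W x = 0 := fun i =>
          Set.indicator_of_notMem (fun hi => hx (Set.mem_iUnion.2 ⟨i, hi⟩)) _
        simp only [this, Finset.sum_const_zero]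
        exact tendsto_const_nhds

/-- Radon–Nikodym for the signed measure `A ↦ Λ(1_A W)`, absolutely continuous because `Λ` sees only
classes. Simple functions and dominated convergence extend the formula to bounded multipliers. -/
theorem exists_density {α : Type*} [MeasurableSpace α] {μ : Measure α} [SigmaFinite μ] {p : ℝ}
    (hp : 0 < p) [Fact (1 ≤ ENNReal.ofReal p)] (Λ : Lp ℝ (ENNReal.ofReal p) μ →L[ℝ] ℝ)
    {W : α → ℝ} (hW : MemLp W (ENNReal.ofReal p) μ) (hWm : Measurable W) (hW0 : ∀ x, 0 < W x) :
    ∃ φ : α → ℝ, Measurable φ ∧ Integrable φ μ ∧ ∀ (b : α → ℝ) (c : ℝ), Measurable b →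
      (∀ x, |b x| ≤ c) → evalFun Λ (fun x => b x * W x) = ∫ x, b x * φ x ∂μ := by
  set m := weightedMeasure hp Λ hW hWm hW0 with hm
  have hmA : ∀ A, MeasurableSet A → m A = evalFun Λ (A.indicator W) := fun A hA => if_pos hA
  have hac : m ≪ᵥ μ.toENNRealVectorMeasure := by
    refine VectorMeasure.AbsolutelyContinuous.mk fun A hA h0 => ?_
    rw [Measure.toENNRealVectorMeasure_apply_measurable hA] at h0
    rw [hmA A hA]
    have h1 : A.indicator W =ᵐ[μ] fun _ => 0 := by
      have : ∀ᵐ x ∂μ, x ∉ A := measure_eq_zero_iff_ae_notMem.1 h0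
      filter_upwards [this] with x hx using Set.indicator_of_notMem hx _
    rw [evalFun_congr_ae Λ (hW.indicator hA) h1]
    have := evalFun_const_mul Λ (MemLp.zero (α := α) (μ := μ) (p := ENNReal.ofReal p) (ε := ℝ)) 0
    simpa using this
  have hrn := SignedMeasure.withDensityᵥ_rnDeriv_eq m μ hac
  have hint := SignedMeasure.integrable_rnDeriv m μ
  refine ⟨m.rnDeriv μ, SignedMeasure.measurable_rnDeriv _ _, hint, ?_⟩
  set φ := m.rnDeriv μ
  have hset : ∀ A, MeasurableSet A → evalFun Λ (A.indicator W) = ∫ x in A, φ x ∂μ := by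
    intro A hA
    rw [← hmA A hA, ← hrn, withDensityᵥ_apply hint hA]
  have hsbd : ∀ b : SimpleFunc α ℝ, ∃ c, ∀ x, |b x| ≤ c := fun b => by
    obtain ⟨c, hc⟩ := b.exists_forall_norm_le
    exact ⟨c, hc⟩
  have hsimple : ∀ b : SimpleFunc α ℝ,
      evalFun Λ (fun x => b x * W x) = ∫ x, b x * φ x ∂μ := by
    intro b
    induction b using SimpleFunc.induction with
    | const c hA =>
      rename_i A
      have e1 : (fun x => (SimpleFunc.piecewise A hA (SimpleFunc.const α c)
          (SimpleFunc.const α 0)) x * W x) = fun x => c * A.indicator W x := by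
        funext x
        by_cases hx : x ∈ A <;> simp [hx]
      have e2 : (fun x => (SimpleFunc.piecewise A hA (SimpleFunc.const α c)
          (SimpleFunc.const α 0)) x * φ x) = fun x => c * A.indicator φ x := by
        funext x
        by_cases hx : x ∈ A <;> simp [hx]
      rw [e1, e2, evalFun_const_mul Λ (hW.indicator hA), hset A hA, integral_const_mul,
        integral_indicator hA]
    | add _ hf hg =>
      rename_i f g _
      obtain ⟨cf, hcf⟩ := hsbd f
      obtain ⟨cg, hcg⟩ := hsbd g
      simp only [SimpleFunc.coe_add, Pi.add_apply, add_mul]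
      rw [evalFun_add Λ (memLp_mul_of_bounded hW f.measurable hcf)
        (memLp_mul_of_bounded hW g.measurable hcg), hf, hg, integral_add]
      · exact hint.bdd_mul (c := cf) f.measurable.aestronglyMeasurable (ae_of_all _ hcf)
      · exact hint.bdd_mul (c := cg) g.measurable.aestronglyMeasurable (ae_of_all _ hcg)
  intro b c hb hbc
  by_cases hne : Nonempty α
  swap
  · rw [not_nonempty_iff] at hne
    have : b = (0 : SimpleFunc α ℝ) := funext fun x => hne.elim x
    rw [this]
    exact hsimple 0
  have hc0 : 0 ≤ c := (abs_nonneg _).trans (hbc hne.some)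
  have hbs := hb.stronglyMeasurable
  have hab : ∀ n x, |hbs.approxBounded c n x| ≤ c := fun n x =>
    hbs.norm_approxBounded_le hc0 n x
  have hlim : ∀ x, Filter.Tendsto (fun n => hbs.approxBounded c n x) Filter.atTop
      (nhds (b x)) := fun x => hbs.tendsto_approxBounded_of_norm_le (hbc x)
  have ht1 : Filter.Tendsto (fun n => evalFun Λ (fun x => hbs.approxBounded c n x * W x))
      Filter.atTop (nhds (evalFun Λ (fun x => b x * W x))) := by
    have hdom : ∀ (a : ℝ) x, |a| ≤ c → |a * W x| ≤ c * W x := fun a x ha => by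
      rw [abs_mul, abs_of_pos (hW0 x)]
      exact mul_le_mul_of_nonneg_right ha (hW0 x).le
    exact tendsto_evalFun_of_dominated hp Λ (hW.const_mul c)
      (fun n => (SimpleFunc.measurable _).mul hWm) (hb.mul hWm)
      (fun n x => hdom _ x (hab n x)) (fun x => hdom _ x (hbc x))
      (fun x => (hlim x).mul_const _)
  have ht2 : Filter.Tendsto (fun n => ∫ x, hbs.approxBounded c n x * φ x ∂μ)
      Filter.atTop (nhds (∫ x, b x * φ x ∂μ)) := by
    refine tendsto_integral_of_dominated_convergence (fun x => c * |φ x|)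
      (fun n => ((SimpleFunc.measurable _).aestronglyMeasurable.mul hint.1))
      (hint.abs.const_mul c) (fun n => ae_of_all _ fun x => ?_)
      (ae_of_all _ fun x => (hlim x).mul_const _)
    rw [norm_mul]
    exact mul_le_mul_of_nonneg_right (hab n x) (abs_nonneg _)
  simp only [hsimple] at ht1
  exact tendsto_nhds_unique ht1 ht2

/-- Every continuous functional on `L^p`, `1 < p < ∞`, is the pairing with a function in `L^q`. -/
theorem exists_memLp_forall_eq_integral {α : Type*} [MeasurableSpace α] {μ : Measure α}
    [SigmaFinite μ] {p q : ℝ} (hpq : p.HolderConjugate q) [Fact (1 ≤ ENNReal.ofReal p)]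
    (Λ : Lp ℝ (ENNReal.ofReal p) μ →L[ℝ] ℝ) :
    ∃ f : α → ℝ, Measurable f ∧ MemLp f (ENNReal.ofReal q) μ ∧
      ∀ u : Lp ℝ (ENNReal.ofReal p) μ, Λ u = ∫ x, u x * f x ∂μ := by
  have hp0 : 0 < p := hpq.pos
  have hq0 : 0 < q := hpq.symm.pos
  obtain ⟨w, hwm, hw0, hwp⟩ := exists_pos_weight μ hp0
  set W : α → ℝ := fun x => (w x : ℝ) with hWdef
  have hWm : Measurable W := hwm.coe_nnreal_real
  have hW0 : ∀ x, 0 < W x := fun x => NNReal.coe_pos.2 (hw0 x)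
  have hWe : ∀ x, ‖W x‖ₑ = w x := fun x => by simp [hWdef]
  have hW : MemLp W (ENNReal.ofReal p) μ := by
    rw [memLp_ofReal_iff hp0 hWm.aestronglyMeasurable]
    simp only [hWe]
    exact hwp.lt_top
  obtain ⟨φ, hφm, hφi, hφ⟩ := exists_density hp0 Λ hW hWm hW0
  -- Dividing out the weight: `Λ(bW) = ∫ bφ = ∫ (bW) f`.
  set f : α → ℝ := fun x => φ x / W x with hf
  have hfm : Measurable f := hφm.div hWm
  have hfφ : ∀ x, W x * f x = φ x := fun x => mul_div_cancel₀ _ (hW0 x).ne'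
  have htest : ∀ u : α → ℝ≥0∞, Measurable u → (∃ n : ℕ, ∀ x, u x ≤ n * w x) →
      ∫⁻ x, u x * ‖f x‖ₑ ∂μ ≤ ‖Λ‖ₑ * (∫⁻ x, u x ^ p ∂μ) ^ (1 / p) := by
    rintro u hum ⟨n, hun⟩
    have hufin : ∀ x, u x ≠ ∞ := fun x => ne_top_of_le_ne_top
      (ENNReal.mul_ne_top (ENNReal.natCast_ne_top n) ENNReal.coe_ne_top) (hun x)
    set σ : α → ℝ := fun x => if 0 ≤ φ x then 1 else -1 with hσ
    have hσm : Measurable σ :=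
      Measurable.ite (measurableSet_le measurable_const hφm) measurable_const measurable_const
    have hσφ : ∀ x, σ x * φ x = |φ x| := fun x => by
      by_cases h : 0 ≤ φ x
      · simp [hσ, h, abs_of_nonneg h]
      · simp [hσ, h, abs_of_neg (not_le.1 h)]
    have hσ1 : ∀ x, |σ x| = 1 := fun x => by
      by_cases h : 0 ≤ φ x <;> simp [hσ, h]
    -- Chosen so that `bφ = u|f|` while `|bW| = u`; the domination of `u` by `n w` makes `b`
    -- bounded.
    set b : α → ℝ := fun x => (u x).toReal / W x * σ x with hb
    have hbm : Measurable b := (hum.ennreal_toReal.div hWm).mul hσm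
    have hbn : ∀ x, |b x| ≤ n := fun x => by
      rw [hb]
      simp only [abs_mul, hσ1, mul_one, abs_div, abs_of_pos (hW0 x),
        abs_of_nonneg ENNReal.toReal_nonneg]
      rw [div_le_iff₀ (hW0 x)]
      have := ENNReal.toReal_mono (ENNReal.mul_ne_top (ENNReal.natCast_ne_top n)
        ENNReal.coe_ne_top) (hun x)
      simpa using this
    have hbφ : ∀ x, b x * φ x = (u x).toReal * |f x| := fun x => by
      have : |f x| = |φ x| / W x := by rw [hf]; simp only [abs_div, abs_of_pos (hW0 x)]
      rw [this, ← hσφ, hb]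
      ring
    have hbW : ∀ x, b x * W x = (u x).toReal * σ x := fun x => by
      have := (hW0 x).ne'
      rw [hb]
      field_simp
    have hmem := memLp_mul_of_bounded hW hbm hbn
    have hΛ : Λ (hmem.toLp _) = ∫ x, b x * φ x ∂μ := by
      rw [← evalFun_eq Λ hmem, hφ b n hbm hbn]
    have hbi : Integrable (fun x => b x * φ x) μ :=
      hφi.bdd_mul (c := n) hbm.aestronglyMeasurable (ae_of_all _ hbn)
    calc ∫⁻ x, u x * ‖f x‖ₑ ∂μ = ∫⁻ x, ENNReal.ofReal (b x * φ x) ∂μ := by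
          refine lintegral_congr fun x => ?_
          rw [hbφ, ENNReal.ofReal_mul ENNReal.toReal_nonneg, ENNReal.ofReal_toReal (hufin x),
            Real.enorm_eq_ofReal_abs]
      _ = ENNReal.ofReal (∫ x, b x * φ x ∂μ) := by
          rw [ofReal_integral_eq_lintegral_ofReal hbi (ae_of_all _ fun x => ?_)]
          simp only [hbφ, Pi.zero_apply]
          positivity
      _ ≤ ‖Λ (hmem.toLp _)‖ₑ := by
          rw [← hΛ, Real.enorm_eq_ofReal_abs]
          exact ENNReal.ofReal_le_ofReal (le_abs_self _)
      _ ≤ ‖Λ‖ₑ * ‖hmem.toLp _‖ₑ := Λ.le_opENorm _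
      _ = ‖Λ‖ₑ * (∫⁻ x, u x ^ p ∂μ) ^ (1 / p) := by
          rw [Lp.enorm_toLp, eLpNorm_eq_lintegral_rpow_enorm_toReal (by simpa using hp0)
            ENNReal.ofReal_ne_top, ENNReal.toReal_ofReal hp0.le]
          congr 2
          refine lintegral_congr fun x => ?_
          rw [hbW, Real.enorm_eq_ofReal_abs, abs_mul, hσ1, mul_one,
            abs_of_nonneg ENNReal.toReal_nonneg, ENNReal.ofReal_toReal (hufin x)]
  have hfq : MemLp f (ENNReal.ofReal q) μ := by
    rw [memLp_ofReal_iff hq0 hfm.aestronglyMeasurable]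
    refine (lintegral_rpow_le_of_forall_lintegral_mul_le hpq hfm.enorm hwm.coe_nnreal_ennreal
      (fun x => ENNReal.coe_ne_zero.2 (hw0 x).ne') hwp htest).trans_lt ?_
    exact ENNReal.rpow_lt_top_of_nonneg hq0.le (by simp [enorm_ne_top])
  refine ⟨f, hfm, hfq, fun u => ?_⟩
  obtain ⟨v, hvm, huv⟩ : ∃ v : α → ℝ, Measurable v ∧ u =ᵐ[μ] v :=
    ⟨_, (Lp.stronglyMeasurable u).measurable, Filter.EventuallyEq.rfl⟩
  have hv : MemLp v (ENNReal.ofReal p) μ := (Lp.memLp u).ae_eq huv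
  have hΛu : Λ u = evalFun Λ v := by
    rw [← evalFun_congr_ae Λ (Lp.memLp u) huv, evalFun_eq Λ (Lp.memLp u), Lp.toLp_coeFn]
  have hint : ∫ x, u x * f x ∂μ = ∫ x, v x * f x ∂μ :=
    integral_congr_ae (by filter_upwards [huv] with x hx; rw [hx])
  rw [hΛu, hint]
  -- `v/W` truncated at `±n`: the density formula applies to `b n`, and `b n · W → v` under the
  -- dominating function `|v|`.
  set b : ℕ → α → ℝ := fun n x => max (-n) (min n (v x / W x)) with hb
  have hbm : ∀ n, Measurable (b n) := fun n =>
    measurable_const.max (measurable_const.min (hvm.div hWm))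
  have hbn : ∀ n x, |b n x| ≤ n := fun n x => by
    have hn : (0 : ℝ) ≤ n := Nat.cast_nonneg n
    exact abs_le.2 ⟨le_max_left _ _, max_le (by linarith) (min_le_left _ _)⟩
  have hbv : ∀ n x, |b n x * W x| ≤ |v x| := fun n x => by
    have hn : (0 : ℝ) ≤ n := Nat.cast_nonneg n
    have h1 : |b n x| ≤ |v x / W x| := by
      refine abs_le.2 ⟨?_, ?_⟩
      · refine le_max_of_le_right (le_min ?_ (neg_abs_le _))
        linarith [abs_nonneg (v x / W x)]
      · refine max_le ?_ ((min_le_right _ _).trans (le_abs_self _))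
        linarith [abs_nonneg (v x / W x)]
    rw [abs_mul, abs_of_pos (hW0 x)]
    rwa [abs_div, abs_of_pos (hW0 x), le_div_iff₀ (hW0 x)] at h1
  have hlim : ∀ x, Filter.Tendsto (fun n => b n x * W x) Filter.atTop (nhds (v x)) := fun x => by
    refine tendsto_const_nhds.congr' ?_
    obtain ⟨N, hN⟩ := exists_nat_ge |v x / W x|
    filter_upwards [Filter.eventually_ge_atTop N] with n hn
    have hNn : (N : ℝ) ≤ n := by exact_mod_cast hn
    have h1 := abs_le.1 (hN.trans hNn)
    have : b n x = v x / W x := by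
      rw [hb]
      simp only
      rw [min_eq_right h1.2, max_eq_right h1.1]
    rw [this, div_mul_cancel₀ _ (hW0 x).ne']
  have ht1 := tendsto_evalFun_of_dominated hp0 Λ hv.abs (fun n => (hbm n).mul hWm) hvm hbv
    (fun x => le_rfl) hlim
  have hconj : (ENNReal.ofReal p).HolderConjugate (ENNReal.ofReal q) := hpq.ennrealOfReal
  have hvf : Integrable (fun x => v x * f x) μ := hv.integrable_mul hfq
  have ht2 : Filter.Tendsto (fun n => ∫ x, (b n x * W x) * f x ∂μ) Filter.atTop
      (nhds (∫ x, v x * f x ∂μ)) := by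
    refine tendsto_integral_of_dominated_convergence (fun x => |v x * f x|)
      (fun n => (((hbm n).mul hWm).mul hfm).aestronglyMeasurable) hvf.abs
      (fun n => ae_of_all _ fun x => ?_) (ae_of_all _ fun x => (hlim x).mul_const _)
    rw [norm_mul, abs_mul]
    exact mul_le_mul_of_nonneg_right (hbv n x) (abs_nonneg _)
  refine tendsto_nhds_unique ht1 (ht2.congr fun n => ?_)
  change _ = evalFun Λ (fun x => b n x * W x)
  rw [hφ (b n) n (hbm n) (hbn n)]
  refine integral_congr_ae (ae_of_all _ fun x => ?_)
  simp only
  rw [mul_assoc, hfφ]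

/-! ### The signed Gowers form and Gowers–Cauchy–Schwarz -/

/-- Measurable functions in `L^{p_k}`. -/
def MemPk {d : ℕ} (k : ℕ) (f : EuclideanSpace ℝ (Fin d) → ℝ) : Prop :=
  Measurable f ∧ ∫⁻ x, ‖f x‖ₑ ^ pReal k < ∞

/-- The signed multilinear Gowers form. -/
def cubeForm {d k : ℕ} (F : (Fin k → Bool) → EuclideanSpace ℝ (Fin d) → ℝ) : ℝ :=
  ∫ z, cubeProd F z

/-- The cube family with prescribed lower and upper faces in the first direction. -/
def joinFamily {d k : ℕ} (a b : (Fin k → Bool) → EuclideanSpace ℝ (Fin d) → ℝ) :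
    (Fin (k + 1) → Bool) → EuclideanSpace ℝ (Fin d) → ℝ :=
  fun α => if α 0 then b (Fin.tail α) else a (Fin.tail α)

theorem joinFamily_const {d k : ℕ} (f : EuclideanSpace ℝ (Fin d) → ℝ) :
    joinFamily (fun _ : Fin k → Bool => f) (fun _ => f) = fun _ => f := by
  funext α
  simp [joinFamily]

theorem joinFamily_faces {d k : ℕ}
    (F : (Fin (k + 1) → Bool) → EuclideanSpace ℝ (Fin d) → ℝ) :
    joinFamily (fun α => F (Fin.cons false α)) (fun α => F (Fin.cons true α)) = F := by
  funext α
  by_cases h : α 0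
  · simp only [joinFamily, h, if_true]
    rw [← h, Fin.cons_self_tail]
  · simp only [joinFamily, h]
    rw [Bool.not_eq_true] at h
    rw [← h, Fin.cons_self_tail]
    simp [h]

theorem pairFamily_joinFamily {d k : ℕ}
    (a b : (Fin k → Bool) → EuclideanSpace ℝ (Fin d) → ℝ) (h : EuclideanSpace ℝ (Fin d)) :
    pairFamily h (joinFamily a b) = fun α x => a α x * b α (x + h) := by
  funext α x
  simp [pairFamily, joinFamily]

theorem cubeProd_pairFamily_joinFamily {d k : ℕ}
    (a b : (Fin k → Bool) → EuclideanSpace ℝ (Fin d) → ℝ) (h₀ x : EuclideanSpace ℝ (Fin d))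
    (h : Fin k → EuclideanSpace ℝ (Fin d)) :
    cubeProd (pairFamily h₀ (joinFamily a b)) (x, h) =
      cubeProd a (x, h) * cubeProd b (x + h₀, h) := by
  rw [pairFamily_joinFamily]
  simp only [cubeProd, Finset.prod_mul_distrib, add_right_comm x]

theorem memPk_joinFamily {d k n : ℕ} {a b : (Fin k → Bool) → EuclideanSpace ℝ (Fin d) → ℝ}
    (ha : ∀ α, MemPk n (a α)) (hb : ∀ α, MemPk n (b α)) (α : Fin (k + 1) → Bool) :
    MemPk n (joinFamily a b α) := by
  unfold joinFamily
  split_ifs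
  · exact hb _
  · exact ha _

theorem enorm_cubeProd {d k : ℕ} (F : (Fin k → Bool) → EuclideanSpace ℝ (Fin d) → ℝ)
    (z : EuclideanSpace ℝ (Fin d) × (Fin k → EuclideanSpace ℝ (Fin d))) :
    ‖cubeProd F z‖ₑ = cubeProd (fun α x => ‖F α x‖ₑ) z := by
  simp only [cubeProd, enorm_eq_nnnorm, nnnorm_prod, ENNReal.ofNNReal_finsetProd]

/-- The `L^{p_k}` bound applied to absolute values; it justifies the uses of Fubini for the signed
form. -/
theorem integrable_cubeProd {d k : ℕ} {F : (Fin k → Bool) → EuclideanSpace ℝ (Fin d) → ℝ}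
    (hF : ∀ α, MemPk k (F α)) : Integrable (cubeProd F) := by
  refine ⟨(measurable_cubeProd fun α => (hF α).1).aestronglyMeasurable, ?_⟩
  rw [hasFiniteIntegral_iff_enorm]
  simp only [enorm_cubeProd]
  refine (lintegral_cubeProd_le fun α => (hF α).1.enorm).trans_lt ?_
  exact ENNReal.prod_lt_top fun α _ =>
    ENNReal.rpow_lt_top_of_nonneg (inv_nonneg.2 (pReal_pos k).le) (hF α).2.ne

theorem integrable_cubeProd_pairFamily {d k : ℕ}
    {F : (Fin (k + 1) → Bool) → EuclideanSpace ℝ (Fin d) → ℝ} (hF : ∀ α, MemPk (k + 1) (F α)) :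
    Integrable fun w : EuclideanSpace ℝ (Fin d) × EuclideanSpace ℝ (Fin d) ×
      (Fin k → EuclideanSpace ℝ (Fin d)) => cubeProd (pairFamily w.1 F) w.2 := by
  have h := (measurePreserving_cubeEquiv d k).integrable_comp_of_integrable
    (integrable_cubeProd hF)
  exact h.congr (ae_of_all _ fun w => cubeProd_cubeEquiv F w)

theorem cubeForm_eq_integral_pairFamily {d k : ℕ}
    (F : (Fin (k + 1) → Bool) → EuclideanSpace ℝ (Fin d) → ℝ) :
    cubeForm F = ∫ w : EuclideanSpace ℝ (Fin d) × EuclideanSpace ℝ (Fin d) ×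
      (Fin k → EuclideanSpace ℝ (Fin d)), cubeProd (pairFamily w.1 F) w.2 := by
  rw [cubeForm, ← (measurePreserving_cubeEquiv d k).integral_comp']
  simp only [cubeProd_cubeEquiv]

theorem cubeForm_succ {d k : ℕ} {F : (Fin (k + 1) → Bool) → EuclideanSpace ℝ (Fin d) → ℝ}
    (hF : ∀ α, MemPk (k + 1) (F α)) : cubeForm F = ∫ h, cubeForm (pairFamily h F) := by
  rw [cubeForm_eq_integral_pairFamily, Measure.volume_eq_prod, integral_prod]
  · rfl
  · exact integrable_cubeProd_pairFamily hF

theorem integrable_cubeForm_pairFamily {d k : ℕ}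
    {F : (Fin (k + 1) → Bool) → EuclideanSpace ℝ (Fin d) → ℝ} (hF : ∀ α, MemPk (k + 1) (F α)) :
    Integrable fun h => cubeForm (pairFamily h F) :=
  (integrable_cubeProd_pairFamily hF).integral_prod_left

/-- Young bounds the integral over `h` of a power of the inner integral, which is therefore finite
for almost every `h`. Inductions on `k` thus apply to the paired functions only almost everywhere.
-/
theorem ae_memPk_mul_shift {d k : ℕ} {f g : EuclideanSpace ℝ (Fin d) → ℝ}
    (hf : MemPk (k + 1) f) (hg : MemPk (k + 1) g) :
    ∀ᵐ h : EuclideanSpace ℝ (Fin d), MemPk k (fun x => f x * g (x + h)) := by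
  have hY := lintegral_pair_rpow_pow_le k hf.1.enorm hg.1.enorm
  have hfin : ∫⁻ h, (∫⁻ x, (‖f x‖ₑ * ‖g (x + h)‖ₑ) ^ pReal k) ^ (k + 1) ≠ ∞ := by
    refine ne_top_of_le_ne_top (ENNReal.mul_ne_top ?_ ?_) hY
    · exact ENNReal.rpow_ne_top_of_nonneg (by positivity) hf.2.ne
    · exact ENNReal.rpow_ne_top_of_nonneg (by positivity) hg.2.ne
  have hm : Measurable fun h => (∫⁻ x, (‖f x‖ₑ * ‖g (x + h)‖ₑ) ^ pReal k) ^ (k + 1) := by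
    refine Measurable.pow_const ?_ _
    refine Measurable.lintegral_prod_right' (f := fun w : EuclideanSpace ℝ (Fin d) ×
      EuclideanSpace ℝ (Fin d) => (‖f w.2‖ₑ * ‖g (w.2 + w.1)‖ₑ) ^ pReal k) ?_
    exact ((hf.1.enorm.comp measurable_snd).mul
      (hg.1.enorm.comp (measurable_snd.add measurable_fst))).pow_const _
  filter_upwards [ae_lt_top hm hfin] with h hh
  refine ⟨hf.1.mul (hg.1.comp (measurable_id.add_const h)), ?_⟩
  simp only [enorm_mul]
  exact lt_top_iff_ne_top.2 fun htop => by simp [htop] at hh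

/-- Moves the difference parameters of a face in front of the two base points. -/
def faceEquiv (d k : ℕ) :
    (Fin k → EuclideanSpace ℝ (Fin d)) × EuclideanSpace ℝ (Fin d) × EuclideanSpace ℝ (Fin d) ≃ᵐ
      EuclideanSpace ℝ (Fin d) × EuclideanSpace ℝ (Fin d) × (Fin k → EuclideanSpace ℝ (Fin d)) :=
  MeasurableEquiv.prodComm.trans MeasurableEquiv.prodAssoc

theorem measurePreserving_faceEquiv (d k : ℕ) : MeasurePreserving (faceEquiv d k) :=
  (measurePreserving_prodAssoc (volume : Measure (EuclideanSpace ℝ (Fin d)))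
    (volume : Measure (EuclideanSpace ℝ (Fin d)))
    (volume : Measure (Fin k → EuclideanSpace ℝ (Fin d)))).comp Measure.measurePreserving_swap

/-- The integral of the product over a face of the cube, in the base point. -/
def faceIntegral {d k : ℕ} (a : (Fin k → Bool) → EuclideanSpace ℝ (Fin d) → ℝ)
    (h : Fin k → EuclideanSpace ℝ (Fin d)) : ℝ :=
  ∫ x, cubeProd a (x, h)

theorem measurable_faceIntegral {d k : ℕ}
    {a : (Fin k → Bool) → EuclideanSpace ℝ (Fin d) → ℝ} (ha : ∀ α, Measurable (a α)) :
    Measurable (faceIntegral a) :=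
  ((measurable_cubeProd ha).stronglyMeasurable.integral_prod_left').measurable

/-- With the differences of the face fixed, the base points `x` and `x + h₀` of the two faces vary
independently, so the inner integral factors. For `a = b` it is a square, the source of positivity.
-/
theorem cubeForm_joinFamily {d k : ℕ} {a b : (Fin k → Bool) → EuclideanSpace ℝ (Fin d) → ℝ}
    (ha : ∀ α, MemPk (k + 1) (a α)) (hb : ∀ α, MemPk (k + 1) (b α)) :
    Integrable (fun h => faceIntegral a h * faceIntegral b h) ∧
      cubeForm (joinFamily a b) = ∫ h, faceIntegral a h * faceIntegral b h := by
  have hint : Integrable fun w : (Fin k → EuclideanSpace ℝ (Fin d)) ×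
      EuclideanSpace ℝ (Fin d) × EuclideanSpace ℝ (Fin d) =>
      cubeProd a (w.2.2, w.1) * cubeProd b (w.2.2 + w.2.1, w.1) := by
    have h := (measurePreserving_faceEquiv d k).integrable_comp_of_integrable
      (integrable_cubeProd_pairFamily (memPk_joinFamily ha hb))
    exact h.congr (ae_of_all _ fun w => cubeProd_pairFamily_joinFamily a b _ _ _)
  have heq : cubeForm (joinFamily a b) = ∫ w : (Fin k → EuclideanSpace ℝ (Fin d)) ×
      EuclideanSpace ℝ (Fin d) × EuclideanSpace ℝ (Fin d),
      cubeProd a (w.2.2, w.1) * cubeProd b (w.2.2 + w.2.1, w.1) := by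
    rw [cubeForm_eq_integral_pairFamily, ← (measurePreserving_faceEquiv d k).integral_comp']
    exact integral_congr_ae (ae_of_all _ fun w => cubeProd_pairFamily_joinFamily a b _ _ _)
  rw [Measure.volume_eq_prod] at hint heq
  have hinner : ∀ᵐ h : Fin k → EuclideanSpace ℝ (Fin d),
      (∫ y : EuclideanSpace ℝ (Fin d) × EuclideanSpace ℝ (Fin d),
        cubeProd a (y.2, h) * cubeProd b (y.2 + y.1, h)) = faceIntegral a h * faceIntegral b h := by
    filter_upwards [hint.prod_right_ae] with h hh
    rw [Measure.volume_eq_prod] at hh ⊢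
    rw [integral_prod_symm _ hh]
    simp only [integral_const_mul]
    have : ∀ x : EuclideanSpace ℝ (Fin d),
        ∫ y, cubeProd b (x + y, h) = faceIntegral b h := fun x =>
      integral_add_left_eq_self (fun y => cubeProd b (y, h)) x
    simp only [this, integral_mul_const]
    rfl
  refine ⟨hint.integral_prod_left.congr hinner, ?_⟩
  rw [heq, integral_prod _ hint]
  exact integral_congr_ae hinner

theorem cubeForm_joinFamily_self_nonneg {d k : ℕ}
    {a : (Fin k → Bool) → EuclideanSpace ℝ (Fin d) → ℝ} (ha : ∀ α, MemPk (k + 1) (a α)) :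
    0 ≤ cubeForm (joinFamily a a) := by
  rw [(cubeForm_joinFamily ha ha).2]
  exact integral_nonneg fun h => mul_self_nonneg _

theorem cubeForm_const_nonneg {d k : ℕ} {f : EuclideanSpace ℝ (Fin d) → ℝ}
    (hf : MemPk (k + 1) f) : 0 ≤ cubeForm (fun _ : Fin (k + 1) → Bool => f) := by
  rw [← joinFamily_const]
  exact cubeForm_joinFamily_self_nonneg fun _ => hf

theorem lintegral_enorm_faceIntegral_sq {d k : ℕ}
    {a : (Fin k → Bool) → EuclideanSpace ℝ (Fin d) → ℝ} (ha : ∀ α, MemPk (k + 1) (a α)) :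
    ∫⁻ h, ‖faceIntegral a h‖ₑ ^ (2 : ℝ) = ‖cubeForm (joinFamily a a)‖ₑ := by
  obtain ⟨hi, he⟩ := cubeForm_joinFamily ha ha
  rw [Real.enorm_of_nonneg (cubeForm_joinFamily_self_nonneg ha), he,
    ofReal_integral_eq_lintegral_ofReal hi (ae_of_all _ fun h => mul_self_nonneg _)]
  refine lintegral_congr fun h => ?_
  rw [← Real.enorm_of_nonneg (mul_self_nonneg _), enorm_mul, ENNReal.rpow_two, sq]

/-- The Cauchy–Schwarz inequality for the Gowers form in the first direction. -/
theorem enorm_cubeForm_joinFamily_le {d k : ℕ}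
    {a b : (Fin k → Bool) → EuclideanSpace ℝ (Fin d) → ℝ}
    (ha : ∀ α, MemPk (k + 1) (a α)) (hb : ∀ α, MemPk (k + 1) (b α)) :
    ‖cubeForm (joinFamily a b)‖ₑ ≤ ‖cubeForm (joinFamily a a)‖ₑ ^ ((1 : ℝ) / 2) *
      ‖cubeForm (joinFamily b b)‖ₑ ^ ((1 : ℝ) / 2) := by
  rw [(cubeForm_joinFamily ha hb).2, ← lintegral_enorm_faceIntegral_sq ha,
    ← lintegral_enorm_faceIntegral_sq hb]
  refine (enorm_integral_le_lintegral_enorm _).trans ?_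
  simp only [enorm_mul]
  exact ENNReal.lintegral_mul_le_Lp_mul_Lq volume Real.HolderConjugate.two_two
    (measurable_faceIntegral fun α => (ha α).1).enorm.aemeasurable
    (measurable_faceIntegral fun α => (hb α).1).enorm.aemeasurable

/-- The Gowers–Cauchy–Schwarz inequality. -/
theorem enorm_cubeForm_le {d k : ℕ}
    {F : (Fin (k + 1) → Bool) → EuclideanSpace ℝ (Fin d) → ℝ} (hF : ∀ α, MemPk (k + 1) (F α)) :
    ‖cubeForm F‖ₑ ≤
      ∏ α, ‖cubeForm (fun _ : Fin (k + 1) → Bool => F α)‖ₑ ^ ((1 : ℝ) / 2 ^ (k + 1)) := by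
  induction k with
  | zero =>
    rw [prod_cube_succ, Fintype.prod_subsingleton _ default]
    conv_lhs => rw [← joinFamily_faces F]
    have hc : ∀ b : Bool, (fun α : Fin 0 → Bool => F (Fin.cons b α)) =
        fun _ => F (Fin.cons b default) := fun b => by
      funext α
      rw [Subsingleton.elim α default]
    rw [hc, hc]
    refine (enorm_cubeForm_joinFamily_le (fun _ => hF _) (fun _ => hF _)).trans (le_of_eq ?_)
    rw [joinFamily_const, joinFamily_const, show (1 : ℝ) / 2 = 1 / 2 ^ (0 + 1) by norm_num]
  | succ k ih =>
    have hjoin : ∀ (α : Fin (k + 1) → Bool) β, MemPk (k + 2)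
        (joinFamily (fun _ : Fin (k + 1) → Bool => F (Fin.cons false α))
          (fun _ => F (Fin.cons true α)) β) := fun α =>
      memPk_joinFamily (fun _ => hF _) (fun _ => hF _)
    -- A constant family of a paired function is itself a pairing, of the family with one function
    -- on each face. Averaging over `h` therefore gives a mixed form one dimension up.
    have hpj : ∀ (α : Fin (k + 1) → Bool) h,
        (fun _ : Fin (k + 1) → Bool => pairFamily h F α) =
        pairFamily h (joinFamily (fun _ : Fin (k + 1) → Bool => F (Fin.cons false α))
          (fun _ => F (Fin.cons true α))) := fun α h => by
      rw [pairFamily_joinFamily]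
      rfl
    have hmem : ∀ᵐ h : EuclideanSpace ℝ (Fin d), ∀ α, MemPk (k + 1) (pairFamily h F α) :=
      ae_all_iff.2 fun α => ae_memPk_mul_shift (hF _) (hF _)
    calc ‖cubeForm F‖ₑ ≤ ∫⁻ h, ‖cubeForm (pairFamily h F)‖ₑ := by
          rw [cubeForm_succ hF]
          exact enorm_integral_le_lintegral_enorm _
      _ ≤ ∫⁻ h, ∏ α, ‖cubeForm (fun _ : Fin (k + 1) → Bool => pairFamily h F α)‖ₑ ^
            ((1 : ℝ) / 2 ^ (k + 1)) := by
          refine lintegral_mono_ae ?_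
          filter_upwards [hmem] with h hh using ih hh
      _ ≤ ∏ α, (∫⁻ h, ‖cubeForm (fun _ : Fin (k + 1) → Bool => pairFamily h F α)‖ₑ) ^
            ((1 : ℝ) / 2 ^ (k + 1)) := by
          refine ENNReal.lintegral_prod_norm_pow_le _ (fun α _ => ?_) ?_ ?_
          · simp only [hpj]
            exact (integrable_cubeForm_pairFamily (hjoin α)).1.enorm
          · simp
          · intros; positivity
      _ ≤ ∏ α : Fin (k + 1) → Bool,
            (‖cubeForm (fun _ : Fin (k + 2) → Bool => F (Fin.cons false α))‖ₑ ^
                ((1 : ℝ) / 2 ^ (k + 2)) *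
              ‖cubeForm (fun _ : Fin (k + 2) → Bool => F (Fin.cons true α))‖ₑ ^
                ((1 : ℝ) / 2 ^ (k + 2))) := by
          refine Finset.prod_le_prod' fun α _ => ?_
          have hint := integrable_cubeForm_pairFamily (hjoin α)
          -- Positivity loses nothing when absolute values enter the integral over `h`;
          -- Cauchy–Schwarz in the new direction then separates the two faces.
          have hnn : ∀ᵐ h : EuclideanSpace ℝ (Fin d), 0 ≤ cubeForm (pairFamily h
              (joinFamily (fun _ : Fin (k + 1) → Bool => F (Fin.cons false α))
                (fun _ => F (Fin.cons true α)))) := by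
            filter_upwards [hmem] with h hh
            rw [← hpj]
            exact cubeForm_const_nonneg (hh α)
          have heq : ∫⁻ h, ‖cubeForm (fun _ : Fin (k + 1) → Bool => pairFamily h F α)‖ₑ =
              ‖cubeForm (joinFamily (fun _ : Fin (k + 1) → Bool => F (Fin.cons false α))
                (fun _ => F (Fin.cons true α)))‖ₑ := by
            simp only [hpj]
            rw [cubeForm_succ (hjoin α), Real.enorm_of_nonneg (integral_nonneg_of_ae hnn),
              ofReal_integral_eq_lintegral_ofReal hint hnn]
            refine lintegral_congr_ae ?_
            filter_upwards [hnn] with h hh using Real.enorm_of_nonneg hh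
          rw [heq]
          refine (ENNReal.rpow_le_rpow (enorm_cubeForm_joinFamily_le (fun _ => hF _)
            (fun _ => hF _)) (by positivity)).trans (le_of_eq ?_)
          rw [joinFamily_const, joinFamily_const, ENNReal.mul_rpow_of_nonneg _ _ (by positivity),
            ← ENNReal.rpow_mul, ← ENNReal.rpow_mul]
          have e : (1 : ℝ) / 2 * (1 / 2 ^ (k + 1)) = 1 / 2 ^ (k + 2) := by
            field_simp; ring
          rw [e]
      _ = _ := (prod_cube_succ (fun α =>
          ‖cubeForm (fun _ : Fin (k + 2) → Bool => F α)‖ₑ ^ ((1 : ℝ) / 2 ^ (k + 2)))).symm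

/-! ### The Gowers norm as the form on the diagonal -/

theorem gowersNorm_nonneg {d : ℕ} (k : ℕ) (f : EuclideanSpace ℝ (Fin d) → ℝ) :
    0 ≤ gowersNorm k f := by
  induction k using Nat.strong_induction_on generalizing f with
  | _ k ih =>
    match k with
    | 0 => simp [gowersNorm]
    | 1 => simp [gowersNorm]
    | k + 2 =>
      rw [gowersNorm]
      exact Real.rpow_nonneg (integral_nonneg fun h => pow_nonneg (ih (k + 1) (by omega) _) _) _

theorem gowersNorm_congr_ae {d : ℕ} (k : ℕ) {f g : EuclideanSpace ℝ (Fin d) → ℝ}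
    (h : f =ᵐ[volume] g) : gowersNorm k f = gowersNorm k g := by
  induction k using Nat.strong_induction_on generalizing f g with
  | _ k ih =>
    match k with
    | 0 => simp [gowersNorm]
    | 1 => simp [gowersNorm, integral_congr_ae h]
    | k + 2 =>
      rw [gowersNorm, gowersNorm]
      congr 2
      funext t
      congr 1
      refine ih (k + 1) (by omega) ?_
      have hs : ∀ᵐ x : EuclideanSpace ℝ (Fin d), f (x + t) = g (x + t) :=
        (measurePreserving_add_right volume t).quasiMeasurePreserving.ae h
      filter_upwards [h, hs] with x h1 h2
      rw [h1, h2]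

/-- The norm and the form obey the same recursion for almost every `h`; positivity of the form lets
the power undo the root. -/
theorem gowersNorm_pow {d k : ℕ} {f : EuclideanSpace ℝ (Fin d) → ℝ} (hf : MemPk (k + 1) f) :
    gowersNorm (k + 1) f ^ 2 ^ (k + 1) = cubeForm (fun _ : Fin (k + 1) → Bool => f) := by
  induction k generalizing f with
  | zero =>
    have hface : ∀ h : Fin 0 → EuclideanSpace ℝ (Fin d),
        faceIntegral (fun _ : Fin 0 → Bool => f) h = ∫ x, f x := fun h => by
      simp [faceIntegral, cubeProd, cubeDot]
    rw [← joinFamily_const, (cubeForm_joinFamily (fun _ => hf) (fun _ => hf)).2]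
    simp only [hface, gowersNorm]
    rw [Measure.volume_pi_eq_dirac, integral_dirac, zero_add, pow_one, sq_abs, sq]
  | succ k ih =>
    have hae : (fun h : EuclideanSpace ℝ (Fin d) =>
        gowersNorm (k + 1) (fun x => f (x + h) * f x) ^ 2 ^ (k + 1)) =ᵐ[volume]
        fun h => cubeForm (pairFamily h (fun _ : Fin (k + 2) → Bool => f)) := by
      filter_upwards [ae_memPk_mul_shift hf hf] with h hh
      simp only [mul_comm (f (_ + h))]
      rw [ih hh]
      rfl
    rw [gowersNorm, integral_congr_ae hae, ← cubeForm_succ (fun _ => hf), one_div]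
    have := Real.rpow_inv_natCast_pow (cubeForm_const_nonneg (k := k + 1) hf)
      (n := 2 ^ (k + 2)) (by positivity)
    simpa using this

/-! ### Conjugate exponents and independence of representatives -/

/-- The real exponent `2^k / (2^k - k - 1)`. -/
def sReal (k : ℕ) : ℝ := (2 : ℝ) ^ k / ((2 : ℝ) ^ k - (k : ℝ) - 1)

theorem succ_lt_two_pow {k : ℕ} (hk : 2 ≤ k) : (k : ℝ) + 1 < 2 ^ k := by
  have hlt : k + 1 < 2 ^ k := by
    induction k, hk using Nat.le_induction with
    | base => norm_num
    | succ n hn ih => rw [pow_succ]; omega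
  exact_mod_cast hlt

theorem holderConjugate_pReal_sReal {k : ℕ} (hk : 2 ≤ k) :
    (pReal k).HolderConjugate (sReal k) := by
  have h := succ_lt_two_pow hk
  rw [Real.holderConjugate_iff]
  refine ⟨?_, ?_⟩
  · rw [pReal, one_lt_div (by positivity)]
    exact h
  · rw [pReal, sReal, inv_div, inv_div]
    field_simp
    ring

theorem memLp_pExp_iff {d k : ℕ} {f : EuclideanSpace ℝ (Fin d) → ℝ} (hf : Measurable f) :
    MemLp f (pExp k) volume ↔ MemPk k f :=
  (memLp_ofReal_iff (pReal_pos k) hf.aestronglyMeasurable).trans ⟨fun h => ⟨hf, h⟩, fun h => h.2⟩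

theorem exists_memPk_ae_eq {d k : ℕ} {f : EuclideanSpace ℝ (Fin d) → ℝ}
    (hf : MemLp f (pExp k) volume) : ∃ g, MemPk k g ∧ f =ᵐ[volume] g := by
  have hm := hf.1.stronglyMeasurable_mk.measurable
  exact ⟨hf.1.mk f, (memLp_pExp_iff hm).1 (hf.ae_eq hf.1.ae_eq_mk), hf.1.ae_eq_mk⟩

/-- The map `h ↦ α · h` as a linear map. -/
def cubeDotLinear (d : ℕ) {k : ℕ} (α : Fin k → Bool) :
    (Fin k → EuclideanSpace ℝ (Fin d)) →ₗ[ℝ] EuclideanSpace ℝ (Fin d) :=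
  ∑ i, if α i then LinearMap.proj i else 0

theorem cubeDotLinear_apply {d k : ℕ} (α : Fin k → Bool)
    (h : Fin k → EuclideanSpace ℝ (Fin d)) : cubeDotLinear d α h = cubeDot α h := by
  simp only [cubeDotLinear, cubeDot, LinearMap.sum_apply]
  refine Finset.sum_congr rfl fun i _ => ?_
  split_ifs <;> simp

theorem cubeDotLinear_surjective {d k : ℕ} {α : Fin k → Bool} (hα : α ≠ fun _ => false) :
    Function.Surjective (cubeDotLinear d α) := by
  obtain ⟨i, hi⟩ : ∃ i, α i = true := by
    by_contra! h
    exact hα (funext fun i => by simpa using h i)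
  intro y
  refine ⟨Pi.single i y, ?_⟩
  rw [cubeDotLinear_apply, cubeDot, Finset.sum_eq_single i]
  · simp [hi]
  · intro j _ hj
    simp [Pi.single_eq_of_ne hj]
  · simp

/-- A surjective linear map pushes Lebesgue measure to a multiple of Lebesgue measure, possibly
infinite, so null sets pull back to null sets. -/
theorem quasiMeasurePreserving_cubeDot {d k : ℕ} {α : Fin k → Bool} (hα : α ≠ fun _ => false) :
    Measure.QuasiMeasurePreserving
      (cubeDot α : (Fin k → EuclideanSpace ℝ (Fin d)) → EuclideanSpace ℝ (Fin d)) := by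
  refine ⟨measurable_cubeDot α, ?_⟩
  obtain ⟨c, _, hc⟩ := (cubeDotLinear d α).exists_map_addHaar_eq_smul_addHaar
    (volume : Measure (Fin k → EuclideanSpace ℝ (Fin d)))
    (volume : Measure (EuclideanSpace ℝ (Fin d))) (cubeDotLinear_surjective hα)
  have : (cubeDotLinear d α : (Fin k → EuclideanSpace ℝ (Fin d)) → _) = cubeDot α :=
    funext (cubeDotLinear_apply α)
  rw [this] at hc
  rw [hc]
  exact Measure.smul_absolutelyContinuous

/-- Valid at every `x`, since the vertex `0`, whose value would be `f x` itself, is absent. Hence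
`D_k f` depends pointwise only on the class of `f`. -/
theorem dualIntegrand_congr_ae {d k : ℕ} {f g : EuclideanSpace ℝ (Fin d) → ℝ}
    (h : f =ᵐ[volume] g) (x : EuclideanSpace ℝ (Fin d)) :
    dualIntegrand k f x =ᵐ[volume] dualIntegrand k g x := by
  have hx : ∀ᵐ y : EuclideanSpace ℝ (Fin d), f (x + y) = g (x + y) :=
    (measurePreserving_add_left volume x).quasiMeasurePreserving.ae h
  have hα : ∀ α : Fin k → Bool, ∀ᵐ t : Fin k → EuclideanSpace ℝ (Fin d),
      α ≠ (fun _ => false) → f (x + cubeDot α t) = g (x + cubeDot α t) := fun α => by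
    by_cases h0 : α = fun _ => false
    · exact ae_of_all _ fun t h1 => absurd h0 h1
    · filter_upwards [(quasiMeasurePreserving_cubeDot h0).ae hx] with t ht _ using ht
  filter_upwards [ae_all_iff.2 hα] with t ht
  exact Finset.prod_congr rfl fun α hα => ht α (Finset.ne_of_mem_erase hα)

theorem dualFunction_congr_ae {d k : ℕ} {f g : EuclideanSpace ℝ (Fin d) → ℝ}
    (h : f =ᵐ[volume] g) : dualFunction k f = dualFunction k g :=
  funext fun x => integral_congr_ae (dualIntegrand_congr_ae h x)

/-! ### The dual function and its pairings -/

/-- The cube family equal to `g` at the vertex `0` and to `f` at the other vertices. -/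
def pinFamily {d : ℕ} {R : Type*} (k : ℕ) (g f : EuclideanSpace ℝ (Fin d) → R) :
    (Fin k → Bool) → EuclideanSpace ℝ (Fin d) → R :=
  fun α => if α = (fun _ => false) then g else f

theorem pinFamily_self {d k : ℕ} {R : Type*} (f : EuclideanSpace ℝ (Fin d) → R) :
    pinFamily k f f = fun _ => f := by
  funext α
  simp [pinFamily]

theorem prod_pinFamily {d k : ℕ} {R S : Type*} [CommMonoid S]
    (g f : EuclideanSpace ℝ (Fin d) → R)
    (φ : (Fin k → Bool) → (EuclideanSpace ℝ (Fin d) → R) → S) :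
    ∏ α, φ α (pinFamily k g f α) = φ (fun _ => false) g *
      ∏ α ∈ Finset.univ.erase (fun _ : Fin k => false), φ α f := by
  rw [← Finset.mul_prod_erase _ _ (Finset.mem_univ (fun _ : Fin k => false))]
  congr 1
  · simp [pinFamily]
  · exact Finset.prod_congr rfl fun α hα => by simp [pinFamily, Finset.ne_of_mem_erase hα]

theorem cubeProd_pinFamily {d k : ℕ} {R : Type*} [CommMonoid R]
    (g f : EuclideanSpace ℝ (Fin d) → R) (x : EuclideanSpace ℝ (Fin d))
    (h : Fin k → EuclideanSpace ℝ (Fin d)) :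
    cubeProd (pinFamily k g f) (x, h) =
      g x * ∏ α ∈ Finset.univ.erase (fun _ : Fin k => false), f (x + cubeDot α h) := by
  rw [cubeProd, prod_pinFamily g f fun α u => u (x + cubeDot α h)]
  simp [cubeDot]

theorem measurable_dualIntegrand {d k : ℕ} {f : EuclideanSpace ℝ (Fin d) → ℝ}
    (hf : Measurable f) :
    Measurable fun z : EuclideanSpace ℝ (Fin d) × (Fin k → EuclideanSpace ℝ (Fin d)) =>
      dualIntegrand k f z.1 z.2 := by
  unfold dualIntegrand
  refine Finset.measurable_prod _ fun α _ => hf.comp ?_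
  exact measurable_fst.add ((measurable_cubeDot α).comp measurable_snd)

theorem measurable_dualIntegrand_apply {d k : ℕ} {f : EuclideanSpace ℝ (Fin d) → ℝ}
    (hf : Measurable f) (x : EuclideanSpace ℝ (Fin d)) : Measurable (dualIntegrand k f x) := by
  unfold dualIntegrand
  exact Finset.measurable_prod _ fun α _ => hf.comp ((measurable_cubeDot α).const_add x)

theorem measurable_lintegral_dualIntegrand {d k : ℕ} {f : EuclideanSpace ℝ (Fin d) → ℝ}
    (hf : Measurable f) :
    Measurable fun x => ∫⁻ h, ‖dualIntegrand k f x h‖ₑ :=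
  (measurable_dualIntegrand hf).enorm.lintegral_prod_right'

/-- The left side is the form with `u` at the vertex `0` and `|f|` elsewhere, so the `L^{p_k}` bound
applies. -/
theorem lintegral_mul_lintegral_dualIntegrand_le {d k : ℕ}
    {f : EuclideanSpace ℝ (Fin d) → ℝ} (hf : Measurable f)
    {u : EuclideanSpace ℝ (Fin d) → ℝ≥0∞} (hu : Measurable u) :
    ∫⁻ x, u x * ∫⁻ h, ‖dualIntegrand k f x h‖ₑ ≤
      (∏ _α ∈ Finset.univ.erase (fun _ : Fin k => false),
        (∫⁻ x, ‖f x‖ₑ ^ pReal k) ^ (pReal k)⁻¹) * (∫⁻ x, u x ^ pReal k) ^ (1 / pReal k) := by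
  have hm : ∀ α, Measurable (pinFamily k u (fun x => ‖f x‖ₑ) α) := fun α => by
    unfold pinFamily
    split_ifs
    · exact hu
    · exact hf.enorm
  have hx : ∀ x, Measurable fun h : Fin k → EuclideanSpace ℝ (Fin d) =>
      ‖dualIntegrand k f x h‖ₑ := fun x =>
    (measurable_dualIntegrand_apply hf x).enorm
  have hpt : ∀ x h, u x * ‖dualIntegrand k f x h‖ₑ =
      cubeProd (pinFamily k u (fun x => ‖f x‖ₑ)) (x, h) := fun x h => by
    rw [cubeProd_pinFamily]
    simp only [dualIntegrand, enorm_eq_nnnorm, nnnorm_prod, ENNReal.ofNNReal_finsetProd]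
  calc ∫⁻ x, u x * ∫⁻ h, ‖dualIntegrand k f x h‖ₑ
      = ∫⁻ x, ∫⁻ h, cubeProd (pinFamily k u (fun x => ‖f x‖ₑ)) (x, h) := by
        refine lintegral_congr fun x => ?_
        rw [← lintegral_const_mul _ (hx x)]
        exact lintegral_congr fun h => hpt x h
    _ = ∫⁻ z, cubeProd (pinFamily k u (fun x => ‖f x‖ₑ)) z := by
        rw [Measure.volume_eq_prod, lintegral_prod _ (measurable_cubeProd hm).aemeasurable]
    _ ≤ ∏ α, (∫⁻ x, pinFamily k u (fun x => ‖f x‖ₑ) α x ^ pReal k) ^ (pReal k)⁻¹ :=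
        lintegral_cubeProd_le hm
    _ = _ := by
        rw [prod_pinFamily u (fun x => ‖f x‖ₑ) fun _ v => (∫⁻ x, v x ^ pReal k) ^ (pReal k)⁻¹,
          mul_comm, one_div]

/-- The preceding bound is uniform in `u`, so the converse of Hölder's inequality applies. It yields
both absolute convergence and membership of `D_k f` in `L^{s_k}`. -/
theorem lintegral_lintegral_dualIntegrand_rpow_lt_top {d k : ℕ} (hk : 2 ≤ k)
    {f : EuclideanSpace ℝ (Fin d) → ℝ} (hf : MemPk k f) :
    ∫⁻ x, (∫⁻ h, ‖dualIntegrand k f x h‖ₑ) ^ sReal k < ∞ := by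
  obtain ⟨w, hwm, hw0, hwp⟩ :=
    exists_pos_weight (volume : Measure (EuclideanSpace ℝ (Fin d))) (pReal_pos k)
  have hpq := holderConjugate_pReal_sReal hk
  refine (lintegral_rpow_le_of_forall_lintegral_mul_le hpq
    (measurable_lintegral_dualIntegrand hf.1) hwm.coe_nnreal_ennreal
    (fun x => ENNReal.coe_ne_zero.2 (hw0 x).ne') hwp
    (fun u hu _ => lintegral_mul_lintegral_dualIntegrand_le hf.1 hu)).trans_lt ?_
  refine ENNReal.rpow_lt_top_of_nonneg hpq.symm.pos.le (ENNReal.prod_lt_top fun _ _ => ?_).ne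
  exact ENNReal.rpow_lt_top_of_nonneg (inv_nonneg.2 (pReal_pos k).le) hf.2.ne

theorem ae_integrable_dualIntegrand {d k : ℕ} (hk : 2 ≤ k)
    {f : EuclideanSpace ℝ (Fin d) → ℝ} (hf : MemPk k f) :
    ∀ᵐ x : EuclideanSpace ℝ (Fin d), Integrable (dualIntegrand k f x) := by
  have hs := (holderConjugate_pReal_sReal hk).symm.pos
  filter_upwards [ae_lt_top ((measurable_lintegral_dualIntegrand hf.1).pow_const _)
    (lintegral_lintegral_dualIntegrand_rpow_lt_top hk hf).ne] with x hx
  refine ⟨(measurable_dualIntegrand_apply hf.1 x).aestronglyMeasurable, ?_⟩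
  rw [hasFiniteIntegral_iff_enorm]
  exact lt_top_iff_ne_top.2 fun htop => by simp [htop, hs] at hx

theorem memLp_dualFunction {d k : ℕ} (hk : 2 ≤ k)
    {f : EuclideanSpace ℝ (Fin d) → ℝ} (hf : MemPk k f) :
    MemLp (dualFunction k f) (sExp k) volume := by
  have hs := (holderConjugate_pReal_sReal hk).symm.pos
  have hm : StronglyMeasurable (dualFunction k f) :=
    (measurable_dualIntegrand hf.1).stronglyMeasurable.integral_prod_right'
  refine (memLp_ofReal_iff hs hm.aestronglyMeasurable).2 ?_
  refine (lintegral_mono fun x => ENNReal.rpow_le_rpow ?_ hs.le).trans_lt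
    (lintegral_lintegral_dualIntegrand_rpow_lt_top hk hf)
  exact enorm_integral_le_lintegral_enorm _

theorem memPk_pinFamily {d k : ℕ} {g f : EuclideanSpace ℝ (Fin d) → ℝ} (hg : MemPk k g)
    (hf : MemPk k f) (α : Fin k → Bool) : MemPk k (pinFamily k g f α) := by
  unfold pinFamily
  split_ifs
  · exact hg
  · exact hf

theorem integral_mul_dualFunction {d k : ℕ} {g f : EuclideanSpace ℝ (Fin d) → ℝ}
    (hg : MemPk k g) (hf : MemPk k f) :
    ∫ x, g x * dualFunction k f x = cubeForm (pinFamily k g f) := by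
  have hi := integrable_cubeProd (memPk_pinFamily hg hf)
  rw [Measure.volume_eq_prod] at hi
  rw [cubeForm, Measure.volume_eq_prod, integral_prod _ hi]
  simp only [cubeProd_pinFamily, integral_const_mul]
  rfl

theorem gowersNorm_pow_eq_cubeForm {d k : ℕ} (hk : 1 ≤ k) {f : EuclideanSpace ℝ (Fin d) → ℝ}
    (hf : MemPk k f) : gowersNorm k f ^ 2 ^ k = cubeForm (fun _ : Fin k → Bool => f) := by
  obtain ⟨n, rfl⟩ := Nat.exists_eq_add_of_le' hk
  exact gowersNorm_pow hf

theorem abs_integral_mul_dualFunction_le_one {d k : ℕ} (hk : 1 ≤ k)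
    {g f : EuclideanSpace ℝ (Fin d) → ℝ} (hg : MemPk k g) (hf : MemPk k f)
    (hg1 : gowersNorm k g ≤ 1) (hf1 : gowersNorm k f ≤ 1) :
    |∫ x, g x * dualFunction k f x| ≤ 1 := by
  rw [integral_mul_dualFunction hg hf]
  obtain ⟨n, rfl⟩ := Nat.exists_eq_add_of_le' hk
  have hle : ∀ u : EuclideanSpace ℝ (Fin d) → ℝ, MemPk (n + 1) u → gowersNorm (n + 1) u ≤ 1 →
      ‖cubeForm (fun _ : Fin (n + 1) → Bool => u)‖ₑ ≤ 1 := fun u hu hu1 => by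
    rw [← gowersNorm_pow hu, Real.enorm_of_nonneg (pow_nonneg (gowersNorm_nonneg _ _) _)]
    exact ENNReal.ofReal_le_one.2 (pow_le_one₀ (gowersNorm_nonneg _ _) hu1)
  have h : ‖cubeForm (pinFamily (n + 1) g f)‖ₑ ≤ 1 := by
    refine (enorm_cubeForm_le (memPk_pinFamily hg hf)).trans
      (Finset.prod_le_one' fun α _ => ENNReal.rpow_le_one ?_ (by positivity))
    unfold pinFamily
    split_ifs
    · exact hle g hg hg1
    · exact hle f hf hf1
  rwa [Real.enorm_eq_ofReal_abs, ENNReal.ofReal_le_one] at h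

theorem memPk_const_mul {d k : ℕ} {f : EuclideanSpace ℝ (Fin d) → ℝ} (hf : MemPk k f) (c : ℝ) :
    MemPk k (fun x => c * f x) :=
  (memLp_pExp_iff (hf.1.const_mul c)).1 (((memLp_pExp_iff hf.1).2 hf).const_mul c)

theorem gowersNorm_const_mul {d k : ℕ} (hk : 1 ≤ k) {f : EuclideanSpace ℝ (Fin d) → ℝ}
    (hf : MemPk k f) {c : ℝ} (hc : 0 ≤ c) :
    gowersNorm k (fun x => c * f x) = c * gowersNorm k f := by
  refine (pow_left_inj₀ (gowersNorm_nonneg _ _) (mul_nonneg hc (gowersNorm_nonneg _ _))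
    (pow_ne_zero k two_ne_zero)).1 ?_
  rw [gowersNorm_pow_eq_cubeForm hk (memPk_const_mul hf c), mul_pow,
    gowersNorm_pow_eq_cubeForm hk hf, cubeForm, cubeForm, ← integral_const_mul]
  refine integral_congr_ae (ae_of_all _ fun z => ?_)
  simp [cubeProd, Finset.prod_mul_distrib]

/-- The normalised function is an extremiser: with `N = ‖f‖_{U(k)}`, multilinearity gives `⟨f,
D_k(f/N)⟩ = N T(f/N, …, f/N) = N`. -/
theorem integral_mul_dualFunction_normalized {d k : ℕ} (hk : 1 ≤ k)
    {f : EuclideanSpace ℝ (Fin d) → ℝ} (hf : MemPk k f) (h0 : 0 < gowersNorm k f) :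
    gowersNorm k (fun x => (gowersNorm k f)⁻¹ * f x) ≤ 1 ∧
      ∫ x, f x * dualFunction k (fun x => (gowersNorm k f)⁻¹ * f x) x = gowersNorm k f := by
  set N := gowersNorm k f with hN
  have hf' := memPk_const_mul hf N⁻¹
  have h1 : gowersNorm k (fun x => N⁻¹ * f x) = 1 := by
    rw [gowersNorm_const_mul hk hf (inv_nonneg.2 h0.le), ← hN, inv_mul_cancel₀ h0.ne']
  refine ⟨h1.le, ?_⟩
  have h2 : ∫ x, N⁻¹ * f x * dualFunction k (fun x => N⁻¹ * f x) x = 1 := by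
    rw [integral_mul_dualFunction hf' hf', pinFamily_self, ← gowersNorm_pow_eq_cubeForm hk hf',
      h1, one_pow]
  simp only [mul_assoc, integral_const_mul] at h2
  rwa [inv_mul_eq_one₀ h0.ne', eq_comm] at h2

/-! ### The unit ball and the closed convex hull -/

theorem mem_antiUniformUnitBall_iff {d k : ℕ} [Fact (2 ≤ k)]
    {g : Lp ℝ (sExp k) (volume : Measure (EuclideanSpace ℝ (Fin d)))} :
    g ∈ antiUniformUnitBall d k ↔ ∀ f : EuclideanSpace ℝ (Fin d) → ℝ,
      MemLp f (pExp k) volume → gowersNorm k f ≤ 1 → |∫ x, g x * f x| ≤ 1 := by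
  constructor
  · rintro ⟨hb, hs⟩ f hf hf1
    exact (le_csSup hb ⟨f, hf, hf1, rfl⟩).trans hs
  · intro h
    have hle : ∀ r ∈ pairingValues k g, r ≤ 1 := by
      rintro r ⟨f, hf, hf1, rfl⟩
      exact h f hf hf1
    exact ⟨⟨1, hle⟩, Real.sSup_le hle zero_le_one⟩

/-- Pairing against a fixed function in `L^{p_k}` is a continuous functional on `L^{s_k}`. -/
theorem exists_clm_eq_integral {d k : ℕ} [hk : Fact (2 ≤ k)]
    {f : EuclideanSpace ℝ (Fin d) → ℝ} (hf : MemLp f (pExp k) volume) :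
    ∃ Λ : Lp ℝ (sExp k) (volume : Measure (EuclideanSpace ℝ (Fin d))) →L[ℝ] ℝ,
      ∀ g, Λ g = ∫ x, g x * f x := by
  have hpq := holderConjugate_pReal_sReal hk.out
  have : (sExp k).HolderConjugate (pExp k) := hpq.symm.ennrealOfReal
  have : Fact (1 ≤ pExp k) := ⟨by
    rw [pExp, ENNReal.one_le_ofReal]
    exact hpq.lt.le⟩
  refine ⟨((ContinuousLinearMap.mul ℝ ℝ).lpPairing volume (sExp k) (pExp k)).flip (hf.toLp f),
    fun g => ?_⟩
  rw [ContinuousLinearMap.flip_apply, ContinuousLinearMap.lpPairing_eq_integral]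
  refine integral_congr_ae ?_
  filter_upwards [hf.coeFn_toLp] with x hx
  rw [hx]
  rfl

/-- The ball is the intersection, over admissible `f`, of preimages of `[-1, 1]` under continuous
functionals. -/
theorem convex_isClosed_antiUniformUnitBall (d k : ℕ) [Fact (2 ≤ k)] :
    Convex ℝ (antiUniformUnitBall d k) ∧ IsClosed (antiUniformUnitBall d k) := by
  choose! Λ hΛ using fun (f : EuclideanSpace ℝ (Fin d) → ℝ) (hf : MemLp f (pExp k) volume) =>
    exists_clm_eq_integral hf
  have heq : antiUniformUnitBall d k = ⋂ (f : EuclideanSpace ℝ (Fin d) → ℝ)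
      (_ : MemLp f (pExp k) volume) (_ : gowersNorm k f ≤ 1),
      (Λ f) ⁻¹' Metric.closedBall 0 1 := by
    ext g
    simp only [mem_antiUniformUnitBall_iff, Set.mem_iInter, Set.mem_preimage,
      mem_closedBall_zero_iff, Real.norm_eq_abs]
    exact forall₃_congr fun f hf _ => by rw [hΛ f hf]
  rw [heq]
  exact ⟨convex_iInter fun f => convex_iInter fun _ => convex_iInter fun _ =>
      (convex_closedBall 0 1).linear_preimage (Λ f).toLinearMap,
    isClosed_iInter fun f => isClosed_iInter fun _ => isClosed_iInter fun _ =>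
      Metric.isClosed_closedBall.preimage (Λ f).continuous⟩

theorem dualSet_subset_antiUniformUnitBall (d k : ℕ) [hk : Fact (2 ≤ k)] :
    dualSet d k ⊆ antiUniformUnitBall d k := by
  rintro φ ⟨f, hf, hf1, hφ⟩
  rw [mem_antiUniformUnitBall_iff]
  intro g hg hg1
  obtain ⟨f', hf', hff'⟩ := exists_memPk_ae_eq hf
  obtain ⟨g', hg', hgg'⟩ := exists_memPk_ae_eq hg
  rw [gowersNorm_congr_ae k hff'] at hf1
  rw [gowersNorm_congr_ae k hgg'] at hg1
  rw [dualFunction_congr_ae hff'] at hφ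
  have : ∫ x, φ x * g x = ∫ x, g' x * dualFunction k f' x := by
    refine integral_congr_ae ?_
    filter_upwards [hφ, hgg'] with x h1 h2
    rw [h1, h2, mul_comm]
  rw [this]
  exact abs_integral_mul_dualFunction_le_one (one_le_two.trans hk.out) hg' hf' hg1 hf1

theorem antiUniformUnitBall_subset_closedConvexHull (d k : ℕ) [hk : Fact (2 ≤ k)] :
    antiUniformUnitBall d k ⊆ closedConvexHull ℝ (dualSet d k) := by
  intro g hg
  by_contra hgn
  have hk1 : 1 ≤ k := one_le_two.trans hk.out
  obtain ⟨Λ, u, hΛu, hug⟩ := geometric_hahn_banach_closed_point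
    (convex_closedConvexHull (𝕜 := ℝ) (s := dualSet d k)) isClosed_closedConvexHull hgn
  obtain ⟨f, hfm, hfp, hΛ⟩ : ∃ f : EuclideanSpace ℝ (Fin d) → ℝ, Measurable f ∧
      MemLp f (pExp k) volume ∧ ∀ v, Λ v = ∫ x, v x * f x :=
    have : Fact (1 ≤ ENNReal.ofReal (sReal k)) := sExp_fact k
    exists_memLp_forall_eq_integral (holderConjugate_pReal_sReal hk.out).symm Λ
  have hf : MemPk k f := (memLp_pExp_iff hfm).1 hfp
  have hdual : ∀ f' : EuclideanSpace ℝ (Fin d) → ℝ, MemPk k f' → gowersNorm k f' ≤ 1 →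
      ∫ x, f x * dualFunction k f' x < u := by
    intro f' hf' hf1
    have hD := memLp_dualFunction hk.out hf'
    have hmem : hD.toLp _ ∈ dualSet d k :=
      ⟨f', (memLp_pExp_iff hf'.1).2 hf', hf1, hD.coeFn_toLp⟩
    refine lt_of_eq_of_lt ?_ (hΛu _ (subset_closedConvexHull hmem))
    rw [hΛ]
    refine integral_congr_ae ?_
    filter_upwards [hD.coeFn_toLp] with x hx
    rw [hx, mul_comm]
  have hN0 := gowersNorm_nonneg k f
  have hNu : gowersNorm k f < u := by
    -- If the norm vanishes `f` cannot be normalised, but it is itself admissible and `⟨f, D_k f⟩ =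
    -- 0`, so `0 < u`.
    rcases hN0.eq_or_lt with h0 | h0
    · have h := hdual f hf (by rw [← h0]; exact zero_le_one)
      rw [integral_mul_dualFunction hf hf, pinFamily_self, ← gowersNorm_pow_eq_cubeForm hk1 hf,
        ← h0, zero_pow (pow_ne_zero k two_ne_zero)] at h
      rwa [← h0]
    · obtain ⟨h1, h2⟩ := integral_mul_dualFunction_normalized hk1 hf h0
      have h := hdual _ (memPk_const_mul hf _) h1
      rwa [h2] at h
  have hu : 0 < u := hN0.trans_lt hNu
  have hscaled := memPk_const_mul hf u⁻¹
  -- Scaling by `u⁻¹` rather than by the inverse norm covers both cases at once.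
  have h := mem_antiUniformUnitBall_iff.1 hg _ ((memLp_pExp_iff hscaled.1).2 hscaled) (by
    rw [gowersNorm_const_mul hk1 hf (inv_nonneg.2 hu.le), inv_mul_le_iff₀ hu, mul_one]
    exact hNu.le)
  simp only [mul_left_comm _ u⁻¹, integral_const_mul] at h
  rw [← hΛ] at h
  have h3 := (le_abs_self _).trans h
  rw [inv_mul_le_iff₀ hu, mul_one] at h3
  exact absurd hug (not_lt.2 h3)

end AntiUniform

end

theorem lemma3 (d k : ℕ) [Fact (2 ≤ k)] :
    (∀ f : EuclideanSpace ℝ (Fin d) → ℝ, MemLp f (AntiUniform.pExp k) volume →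
      (∀ᵐ x : EuclideanSpace ℝ (Fin d),
        Integrable (AntiUniform.dualIntegrand k f x) volume) ∧
      MemLp (AntiUniform.dualFunction k f) (AntiUniform.sExp k) volume) ∧
    AntiUniform.antiUniformUnitBall d k =
      closedConvexHull ℝ (AntiUniform.dualSet d k) := by
  have hk : 2 ≤ k := Fact.out
  refine ⟨fun f hf => ?_, Set.Subset.antisymm
    (AntiUniform.antiUniformUnitBall_subset_closedConvexHull d k)
    (closedConvexHull_min (AntiUniform.dualSet_subset_antiUniformUnitBall d k)
      (AntiUniform.convex_isClosed_antiUniformUnitBall d k).1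
      (AntiUniform.convex_isClosed_antiUniformUnitBall d k).2)⟩
  obtain ⟨g, hg, hfg⟩ := AntiUniform.exists_memPk_ae_eq hf
  refine ⟨?_, ?_⟩
  · filter_upwards [AntiUniform.ae_integrable_dualIntegrand hk hg] with x hx
    exact hx.congr (AntiUniform.dualIntegrand_congr_ae hfg x).symm
  · rw [AntiUniform.dualFunction_congr_ae hfg]
    exact AntiUniform.memLp_dualFunction hk hg
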